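/- Let $\Omega\subseteq\mathbb R^2$ be open and let $(q,r)$ be a twice continuously differentiable complex solution on $\Omega$ (variables $(x,t)$) of the coupled Chen--Lee--Liu nonlinear Schrödinger system $$r_t-\mathrm i r_{xx}+\mathrm i r^2q+rqr_x=0,\qquad q_t+\mathrm i q_{xx}-\mathrm i q^2r+qrq_x=0 .$$ With $\sigma_3=\begin{pmatrix}1&0\\0&-1\end{pmatrix}$ and $Q=\begin{pmatrix}0&r\\q&0\end{pmatrix}$, its Lax pair is $\Phi_x=U\Phi$, $\Phi_t=V\Phi$, where $$U=\mathrm i\sigma_3\lambda^2+Q\lambda-\tfrac12\mathrm i\sigma_3+\tfrac14\mathrm iQ^2\sigma_3,$$ $$V=-2\mathrm i\sigma_3\lambda^4-2Q\lambda^3+(2\mathrm i\sigma_3-\mathrm iQ^2\sigma_3)\lambda^2+(Q+\mathrm i\sigma_3Q_x-\tfrac12Q^3)\lambda-\tfrac12\mathrm i\sigma_3-\tfrac18\mathrm iQ^4\sigma_3+\tfrac14(QQ_x-Q_xQ).$$ Let $n\ge1$, let $\lambda_1,\dots,\lambda_n\in\mathbb C$, let $\Phi_k=(f_k,g_k)^T$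 be a $C^2$ solution on $\Omega$ of the Lax pair at $\lambda=\lambda_k$, and let $H$ be a nowhere vanishing $C^2$ function on $\Omega$ with $$H_x=\tfrac12\mathrm i(qr-2)H,\qquad H_t=-\tfrac14(4\mathrm i+\mathrm iq^2r^2-2rq_x+2qr_x)H .$$ Let $\Delta_n^1,\dots,\Delta_n^4$ be the $n\times n$ matrices whose $k$-th rows are, respectively, $$(\lambda_k^{n-1}f_k,\lambda_k^{n-2}g_k,\lambda_k^{n-3}f_k,\lambda_k^{n-4}g_k,\dots),\qquad(\lambda_k^{n-1}g_k,\lambda_k^{n-2}f_k,\lambda_k^{n-3}g_k,\lambda_k^{n-4}f_k,\dots),$$ $$(\lambda_k^{n}f_k,\lambda_k^{n-2}f_k,\lambda_k^{n-3}g_k,\lambda_k^{n-4}f_k,\dots),\qquad(\lambda_k^{n}g_k,\lambda_k^{n-2}g_k,\lambda_k^{n-3}f_k,\lambda_k^{n-4}g_k,\dots)$$ (from the second entry on, the power drops by one and $f_k,g_k$ alternate, down to power $0$), and assume that $|\Delta_n^1|$ and $|\Delta_n^2|$ vanish nowhere on $\Omega$, where $|\cdot|$ is the determinant. Put $$\begin{aligned}\xi_n^1&=(0,\lambda^{n-2},0,\lambda^{n-4},\dots),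 & \xi_n^2&=(\lambda^{n-1},0,\lambda^{n-3},0,\dots),\\ \eta_n^1&=(\lambda_1^nf_1,\dots,\lambda_n^nf_n)^T, & \eta_n^2&=(\lambda_1^ng_1,\dots,\lambda_n^ng_n)^T,\end{aligned}$$ with $\xi_n^1,\xi_n^2$ of length $n$, and let the $n$-fold Darboux matrix be $$T_n=\frac{1}{\sqrt{|\Delta_n^1||\Delta_n^2|}}\,G\begin{pmatrix}\begin{vmatrix}\lambda^n&\xi_n^1\\\eta_n^1&\Delta_n^2\end{vmatrix}&\begin{vmatrix}0&\xi_n^2\\\eta_n^1&\Delta_n^2\end{vmatrix}\\[3mm]\begin{vmatrix}0&\xi_n^2\\\eta_n^2&\Delta_n^1\end{vmatrix}&\begin{vmatrix}\lambda^n&\xi_n^1\\\eta_n^2&\Delta_n^1\end{vmatrix}\end{pmatrix},$$ where $G$ is the identity for even $n$ and $G=\operatorname{diag}(\sqrt H,1/\sqrt H)$ for odd $n$. Define $$r_n=\begin{cases}\dfrac{|\Delta_n^2|}{|\Delta_n^1|}r+2\mathrm i\dfrac{|\Delta_n^3|}{|\Delta_n^1|}&n\text{ even},\\[3mm] H\left(\dfrac{|\Delta_n^2|}{|\Delta_n^1|}r+2\mathrm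 i\dfrac{|\Delta_n^3|}{|\Delta_n^1|}\right)&n\text{ odd},\end{cases}\qquad q_n=\begin{cases}\dfrac{|\Delta_n^1|}{|\Delta_n^2|}q-2\mathrm i\dfrac{|\Delta_n^4|}{|\Delta_n^2|}&n\text{ even},\\[3mm] \dfrac1H\left(\dfrac{|\Delta_n^1|}{|\Delta_n^2|}q-2\mathrm i\dfrac{|\Delta_n^4|}{|\Delta_n^2|}\right)&n\text{ odd}.\end{cases}$$ Then $(q_n,r_n)$ is again a $C^2$ solution of the coupled system on $\Omega$, and it is the solution produced by $T_n$: for all differentiable branches on $\Omega$ of $\sqrt{|\Delta_n^1||\Delta_n^2|}$ and $\sqrt H$, one has $T_n|_{\lambda=\lambda_k}\Phi_k=0$ for every $k$, and, for functions $q',r'$ on $\Omega$, $T_n$ is a Darboux transformation from $(q,r)$ to $(q',r')$ if and only if $q'=q_n$ and $r'=r_n$ on $\Omega$. Here a Darboux transformation is a matrix $T$ that is differentiable in $(x,t)$ for each $\lambda\in\mathbb C$, whose determinant at each point of $\Omega$ is not identically zero in $\lambda$, and for which $T_x+TU=U'T$ and $T_t+TV=V'T$ for all $\lambda$, where $U',V'$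 are $U,V$ with $(q,r)$ replaced by $(q',r')$. -/

import Mathlib

namespace CLLNLS

noncomputable section

open Complex Matrix

/-! Functions of the two real variables `p = (x, t)` with complex values. -/

/-- Partial derivative with respect to `x`. -/
def dx (u : ℝ × ℝ → ℂ) (p : ℝ × ℝ) : ℂ := deriv (fun y : ℝ => u (y, p.2)) p.1

/-- Partial derivative with respect to `t`. -/
def dt (u : ℝ × ℝ → ℂ) (p : ℝ × ℝ) : ℂ := deriv (fun s : ℝ => u (p.1, s)) p.2

/-- Entrywise partial `x`-derivative of a matrix-valued function. -/
def matDx (M : ℝ × ℝ → Matrix (Fin 2) (Fin 2) ℂ) (p : ℝ × ℝ) : Matrix (Fin 2) (Fin 2) ℂ :=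
  Matrix.of fun i j => dx (fun p' => M p' i j) p

/-- Entrywise partial `t`-derivative of a matrix-valued function. -/
def matDt (M : ℝ × ℝ → Matrix (Fin 2) (Fin 2) ℂ) (p : ℝ × ℝ) : Matrix (Fin 2) (Fin 2) ℂ :=
  Matrix.of fun i j => dt (fun p' => M p' i j) p

/-- `(q, r)` is a (classical) solution of the coupled CLL-NLS system on the region `Ω`:
`r_t - i r_xx + i r² q + r q r_x = 0` and `q_t + i q_xx - i q² r + q r q_x = 0`. -/
structure IsSolution (Ω : Set (ℝ × ℝ)) (q r : ℝ × ℝ → ℂ) : Prop where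
  smooth_q : ContDiffOn ℝ 2 q Ω
  smooth_r : ContDiffOn ℝ 2 r Ω
  eq_r : ∀ p ∈ Ω,
    dt r p - I * dx (dx r) p + I * r p ^ 2 * q p + r p * q p * dx r p = 0
  eq_q : ∀ p ∈ Ω,
    dt q p + I * dx (dx q) p - I * q p ^ 2 * r p + q p * r p * dx q p = 0

/-- The Pauli matrix `σ₃`. -/
def sigma3 : Matrix (Fin 2) (Fin 2) ℂ := !![1, 0; 0, -1]

/-- The potential matrix `Q`. -/
def Qmat (q r : ℝ × ℝ → ℂ) (p : ℝ × ℝ) : Matrix (Fin 2) (Fin 2) ℂ := !![0, r p; q p, 0]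

/-- The matrix `U` of the Lax pair, with spectral parameter `z`. -/
def laxU (q r : ℝ × ℝ → ℂ) (z : ℂ) (p : ℝ × ℝ) : Matrix (Fin 2) (Fin 2) ℂ :=
  (I * z ^ 2) • sigma3 + z • Qmat q r p - (I / 2) • sigma3
    + (I / 4) • (Qmat q r p ^ 2 * sigma3)

/-- The matrix `V` of the Lax pair, with spectral parameter `z`. -/
def laxV (q r : ℝ × ℝ → ℂ) (z : ℂ) (p : ℝ × ℝ) : Matrix (Fin 2) (Fin 2) ℂ :=
  (-2 * I * z ^ 4) • sigma3 - (2 * z ^ 3) • Qmat q r p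
    + z ^ 2 • ((2 * I) • sigma3 - I • (Qmat q r p ^ 2 * sigma3))
    + z • (Qmat q r p + I • (sigma3 * matDx (Qmat q r) p) - (1 / 2 : ℂ) • Qmat q r p ^ 3)
    - (I / 2) • sigma3 - (I / 8) • (Qmat q r p ^ 4 * sigma3)
    + (1 / 4 : ℂ) • (Qmat q r p * matDx (Qmat q r) p - matDx (Qmat q r) p * Qmat q r p)

/-- `(f, g)ᵀ` is an eigenfunction of the Lax pair of `(q, r)` for the spectral parameter `z`. -/
structure IsEigenfunction (Ω : Set (ℝ × ℝ)) (q r : ℝ × ℝ → ℂ) (z : ℂ)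
    (f g : ℝ × ℝ → ℂ) : Prop where
  smooth_f : ContDiffOn ℝ 2 f Ω
  smooth_g : ContDiffOn ℝ 2 g Ω
  eq_x : ∀ p ∈ Ω, ![dx f p, dx g p] = laxU q r z p *ᵥ ![f p, g p]
  eq_t : ∀ p ∈ Ω, ![dt f p, dt g p] = laxV q r z p *ᵥ ![f p, g p]

/-- `H` is a nowhere vanishing solution of `H_x = (i/2)(qr - 2) H`,
`H_t = -(1/4)(4i + i q² r² - 2 r q_x + 2 q r_x) H`. -/
structure IsOverallFactor (Ω : Set (ℝ × ℝ)) (q r H : ℝ × ℝ → ℂ) : Prop where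
  smooth : ContDiffOn ℝ 2 H Ω
  ne_zero : ∀ p ∈ Ω, H p ≠ 0
  eq_x : ∀ p ∈ Ω, dx H p = I / 2 * (q p * r p - 2) * H p
  eq_t : ∀ p ∈ Ω, dt H p =
    -(1 / 4) * (4 * I + I * q p ^ 2 * r p ^ 2 - 2 * r p * dx q p + 2 * q p * dx r p) * H p

/-- `T = T(λ; x, t)` is a Darboux transformation from `(q, r)` to `(q', r')` on `Ω`: it
intertwines the two Lax pairs, `T_x + T U = U' T` and `T_t + T V = V' T` for all values of the
spectral parameter (so it maps eigenfunctions for `(q, r)` to eigenfunctions for `(q', r')`),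
and it is nondegenerate as a function of the spectral parameter. -/
structure IsDarboux (Ω : Set (ℝ × ℝ)) (q r q' r' : ℝ × ℝ → ℂ)
    (T : ℂ → ℝ × ℝ → Matrix (Fin 2) (Fin 2) ℂ) : Prop where
  diff : ∀ z i j, DifferentiableOn ℝ (fun p => T z p i j) Ω
  nondeg : ∀ p ∈ Ω, ∃ z, (T z p).det ≠ 0
  eq_x : ∀ z, ∀ p ∈ Ω, matDx (T z) p + T z p * laxU q r z p = laxU q' r' z p * T z p
  eq_t : ∀ z, ∀ p ∈ Ω, matDt (T z) p + T z p * laxV q r z p = laxV q' r' z p * T z p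

/-! The matrices at one point: `l k`, `u k`, `v k` are the values of `λ_k`, `f_k`, `g_k`.
Columns are numbered from `0`, so column `j` carries the power `n - 1 - j`. -/

variable {n : ℕ}

/-- Row `k` is `(λ_k^(n-1) f_k, λ_k^(n-2) g_k, λ_k^(n-3) f_k, …)`, ending with
`g_k` for even `n` and with `f_k` for odd `n`. -/
def Delta1 (l u v : Fin n → ℂ) : Matrix (Fin n) (Fin n) ℂ :=
  Matrix.of fun k j => l k ^ (n - 1 - (j : ℕ)) * (if Even (j : ℕ) then u k else v k)

/-- Row `k` is `(λ_k^(n-1) g_k, λ_k^(n-2) f_k, λ_k^(n-3) g_k, …)`, ending with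
`f_k` for even `n` and with `g_k` for odd `n`. -/
def Delta2 (l u v : Fin n → ℂ) : Matrix (Fin n) (Fin n) ℂ :=
  Matrix.of fun k j => l k ^ (n - 1 - (j : ℕ)) * (if Even (j : ℕ) then v k else u k)

/-- Row `k` is `(λ_k^n f_k, λ_k^(n-2) f_k, λ_k^(n-3) g_k, λ_k^(n-4) f_k, …)`:
`Delta2` with its first column replaced by `λ_k^n f_k`. -/
def Delta3 (l u v : Fin n → ℂ) : Matrix (Fin n) (Fin n) ℂ :=
  Matrix.of fun k j => if (j : ℕ) = 0 then l k ^ n * u k else Delta2 l u v k j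

/-- Row `k` is `(λ_k^n g_k, λ_k^(n-2) g_k, λ_k^(n-3) f_k, λ_k^(n-4) g_k, …)`:
`Delta1` with its first column replaced by `λ_k^n g_k`. -/
def Delta4 (l u v : Fin n → ℂ) : Matrix (Fin n) (Fin n) ℂ :=
  Matrix.of fun k j => if (j : ℕ) = 0 then l k ^ n * v k else Delta1 l u v k j

/-- `ξ_n^1 = (0, λ^(n-2), 0, λ^(n-4), …)`. -/
def xi1 (n : ℕ) (z : ℂ) : Fin n → ℂ :=
  fun j => if Even (j : ℕ) then 0 else z ^ (n - 1 - (j : ℕ))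

/-- `ξ_n^2 = (λ^(n-1), 0, λ^(n-3), 0, …)`. -/
def xi2 (n : ℕ) (z : ℂ) : Fin n → ℂ :=
  fun j => if Even (j : ℕ) then z ^ (n - 1 - (j : ℕ)) else 0

/-- The bordered determinant `| c  ξ ; η  D |`. -/
def bordered (c : ℂ) (ξ η : Fin n → ℂ) (D : Matrix (Fin n) (Fin n) ℂ) : ℂ :=
  (Matrix.fromBlocks (Matrix.of fun _ _ : Unit => c) (Matrix.replicateRow Unit ξ)
    (Matrix.replicateCol Unit η) D).det

/-- The matrix of the four determinants `(T_n)_{ij}`. -/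
def Tcore (l u v : Fin n → ℂ) (z : ℂ) : Matrix (Fin 2) (Fin 2) ℂ :=
  !![bordered (z ^ n) (xi1 n z) (fun k => l k ^ n * u k) (Delta2 l u v),
     bordered 0 (xi2 n z) (fun k => l k ^ n * u k) (Delta2 l u v);
     bordered 0 (xi2 n z) (fun k => l k ^ n * v k) (Delta1 l u v),
     bordered (z ^ n) (xi1 n z) (fun k => l k ^ n * v k) (Delta1 l u v)]

/-- The `n`-fold Darboux matrix `T_n(λ; λ_1, …, λ_n)`. Here `s` and `h` stand for branches of
`√(|Δ_n^1| |Δ_n^2|)` and `√H`. -/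
def Tn (l : Fin n → ℂ) (f g : Fin n → ℝ × ℝ → ℂ) (s h : ℝ × ℝ → ℂ)
    (z : ℂ) (p : ℝ × ℝ) : Matrix (Fin 2) (Fin 2) ℂ :=
  if Even n then (1 / s p) • Tcore l (fun k => f k p) (fun k => g k p) z
  else (1 / s p) • (!![h p, 0; 0, 1 / h p] * Tcore l (fun k => f k p) (fun k => g k p) z)

/-- `|Δ_n^1|`, …, `|Δ_n^4|` as functions of `(x, t)`. -/
def det1 (l : Fin n → ℂ) (f g : Fin n → ℝ × ℝ → ℂ) (p : ℝ × ℝ) : ℂ :=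
  (Delta1 l (fun k => f k p) (fun k => g k p)).det


def det2 (l : Fin n → ℂ) (f g : Fin n → ℝ × ℝ → ℂ) (p : ℝ × ℝ) : ℂ :=
  (Delta2 l (fun k => f k p) (fun k => g k p)).det


def det3 (l : Fin n → ℂ) (f g : Fin n → ℝ × ℝ → ℂ) (p : ℝ × ℝ) : ℂ :=
  (Delta3 l (fun k => f k p) (fun k => g k p)).det


def det4 (l : Fin n → ℂ) (f g : Fin n → ℝ × ℝ → ℂ) (p : ℝ × ℝ) : ℂ :=
  (Delta4 l (fun k => f k p) (fun k => g k p)).det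

/-- The determinant expression for `r_n`. -/
def rn (l : Fin n → ℂ) (f g : Fin n → ℝ × ℝ → ℂ) (r H : ℝ × ℝ → ℂ) (p : ℝ × ℝ) : ℂ :=
  if Even n then
    det2 l f g p / det1 l f g p * r p + 2 * I * (det3 l f g p / det1 l f g p)
  else
    H p * (det2 l f g p / det1 l f g p * r p + 2 * I * (det3 l f g p / det1 l f g p))

/-- The determinant expression for `q_n`. -/
def qn (l : Fin n → ℂ) (f g : Fin n → ℝ × ℝ → ℂ) (q H : ℝ × ℝ → ℂ) (p : ℝ × ℝ) : ℂ :=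
  if Even n then
    det1 l f g p / det2 l f g p * q p - 2 * I * (det4 l f g p / det2 l f g p)
  else
    1 / H p * (det1 l f g p / det2 l f g p * q p - 2 * I * (det4 l f g p / det2 l f g p))

end

end CLLNLS

/-!
Write `T = diag(a, a⁻¹) T̂`, where the rows of `T̂` are monic: the first row is
`(z ^ n + ξ¹ ⬝ x, ξ² ⬝ x)` and the second `(ξ² ⬝ y, z ^ n + ξ¹ ⬝ y)`. By Cramer's rule `x` and `y`
are characterized by `T̂ (λ_k) Φ_k = 0`, that is by the linear systems `Δ² x = -η¹` and
`Δ¹ y = -η²`, which are uniquely solvable. This uniqueness is what makes `T̂` a Darboux matrix. For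
`M = U` or `M = V` there is a polynomial `N = M.dress x y` of the same shape for which the terms of
high degree in `T̂ M - N T̂` cancel, so that the rows of this matrix are again of the form
`(ξ¹ ⬝ w, ξ² ⬝ w)` (`xi1_dotProduct_flow`, `xi2_dotProduct_flow`). The rows of the derivative of
`T̂` are of this form too, and `T̂' + T̂ M - N T̂` annihilates `Φ_k` at `λ_k`, so it is zero
(`hasDerivAt_rowCoeff`).

It remains to normalize the diagonal. The lowest coefficient of the first row is a constant times
`|Δ¹| / |Δ²|` (`rowCoeff_last`), and its evolution gives the logarithmic derivative of this
quotient, first for nonzero `λ_k` and then in general by continuity (`detDeriv_Delta2`). Therefore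
`a ^ 2 = H ^ ε |Δ²| / |Δ¹|`, with `ε` the parity of `n`, satisfies exactly the equation under which
the transform of `(U, V)` by `T` is `(U, V)` for the potentials `(q_n, r_n)`. In view of
`q_n = (q + 2 i y_0) / a ^ 2` and `r_n = a ^ 2 (r - 2 i x_0)` this is an identity between
polynomials in the entries of `x` and `y` (`laxPolyU_gauge`, `laxPolyV_gauge`).

Differentiating the two intertwining relations once more shows that `T` also intertwines the
curvatures `U_t - V_x + [U, V]` (`curvature_intertwine`). As `T` is invertible for some `z ≠ 0`, the
curvature of `(q_n, r_n)` vanishes there, and its off-diagonal entries are `z` times the two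
equations of the system (`curvature_eq`). The same invertibility shows that `U'`, hence
`(q', r')`, is determined by the relation `T_x + T U = U' T`.
-/

namespace CLLNLS

noncomputable section

open Complex Matrix Filter Topology

section

/-! ### Rows of polynomials and the shift -/

/-- The left shift `(w_0, w_1, …) ↦ (w_1, w_2, …, 0)` of coefficient vectors. -/
def shift {n : ℕ} (w : Fin n → ℂ) : Fin n → ℂ :=
  fun j => if h : (j : ℕ) + 1 < n then w ⟨j + 1, h⟩ else 0

/-- In contrast to `mul_xi2_dotProduct`, no term of degree `n` appears, as `ξ¹` vanishes in
column `0`. -/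
theorem mul_xi1_dotProduct {n : ℕ} (z : ℂ) (w : Fin n → ℂ) :
    z * (xi1 n z ⬝ᵥ w) = xi2 n z ⬝ᵥ shift w := by
  obtain _ | m := n
  · simp
  simp only [dotProduct]
  rw [Fin.sum_univ_succ, Fin.sum_univ_castSucc]
  simp only [xi1, xi2, shift, Fin.val_zero, Even.zero, if_true, zero_mul, zero_add, Fin.val_last,
    lt_irrefl, dite_false, mul_zero, add_zero, Fin.val_castSucc, Fin.val_succ, Finset.mul_sum]
  refine Finset.sum_congr rfl fun i _ => ?_
  have hi : (i : ℕ) + 1 < m + 1 := by omega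
  have hp : z ^ (m - i : ℕ) = z * z ^ (m - (i + 1) : ℕ) := by
    rw [← pow_succ']; congr 1; omega
  have hs : (⟨(i : ℕ) + 1, hi⟩ : Fin (m + 1)) = i.succ := rfl
  by_cases he : Even (i : ℕ) <;> simp [he, Nat.even_add_one, hs, hp, mul_assoc]

theorem mul_xi2_dotProduct {n : ℕ} [NeZero n] (z : ℂ) (w : Fin n → ℂ) :
    z * (xi2 n z ⬝ᵥ w) = w 0 * z ^ n + xi1 n z ⬝ᵥ shift w := by
  obtain _ | m := n
  · exact absurd rfl (NeZero.ne 0)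
  simp only [dotProduct]
  rw [Fin.sum_univ_succ, Fin.sum_univ_castSucc]
  simp only [xi1, xi2, shift, Fin.val_zero, Even.zero, if_true, Fin.val_last,
    lt_irrefl, dite_false, mul_zero, add_zero, Fin.val_castSucc, Fin.val_succ, Finset.mul_sum,
    mul_add]
  congr 1
  · simp; ring
  refine Finset.sum_congr rfl fun i _ => ?_
  have hi : (i : ℕ) + 1 < m + 1 := by omega
  have hp : z ^ (m - i : ℕ) = z * z ^ (m - (i + 1) : ℕ) := by
    rw [← pow_succ']; congr 1; omega
  have hs : (⟨(i : ℕ) + 1, hi⟩ : Fin (m + 1)) = i.succ := rfl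
  by_cases he : Even (i : ℕ) <;> simp [he, Nat.even_add_one, hs, hp, mul_assoc]

theorem Delta2_mulVec {n : ℕ} (l u v w : Fin n → ℂ) (k : Fin n) :
    (Delta2 l u v *ᵥ w) k = (xi1 n (l k) ⬝ᵥ w) * u k + (xi2 n (l k) ⬝ᵥ w) * v k := by
  simp only [mulVec, dotProduct, Delta2, Matrix.of_apply, xi1, xi2, Finset.sum_mul]
  rw [← Finset.sum_add_distrib]
  refine Finset.sum_congr rfl fun j _ => ?_
  split_ifs <;> ring

theorem Delta1_eq_Delta2 {n : ℕ} (l u v : Fin n → ℂ) : Delta1 l u v = Delta2 l v u := rfl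

/-! ### Solving for the coefficients of the Darboux matrix -/

/-- The lower coefficients `x` of the monic first row `(z ^ n + ξ¹ ⬝ x, ξ² ⬝ x)` of the Darboux
matrix, determined by the requirement that the row annihilates `(u k, v k)` at `z = l k`.
Exchanging `u` and `v` gives the second row, with its two entries exchanged. -/
def rowCoeff {n : ℕ} (l u v : Fin n → ℂ) : Fin n → ℂ :=
  -((Delta2 l u v)⁻¹ *ᵥ fun k => l k ^ n * u k)

theorem Delta2_mulVec_rowCoeff {n : ℕ} {l u v : Fin n → ℂ} (h : (Delta2 l u v).det ≠ 0) :
    Delta2 l u v *ᵥ rowCoeff l u v = -fun k => l k ^ n * u k := by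
  rw [rowCoeff, mulVec_neg, mulVec_mulVec, mul_nonsing_inv _ (isUnit_iff_ne_zero.2 h), one_mulVec]

theorem rowCoeff_annihilates {n : ℕ} {l u v : Fin n → ℂ} (h : (Delta2 l u v).det ≠ 0)
    (k : Fin n) :
    (l k ^ n + xi1 n (l k) ⬝ᵥ rowCoeff l u v) * u k
      + (xi2 n (l k) ⬝ᵥ rowCoeff l u v) * v k = 0 := by
  have := congrFun (Delta2_mulVec_rowCoeff h) k
  rw [Delta2_mulVec, Pi.neg_apply] at this
  linear_combination this

theorem eq_of_Delta2_mulVec_eq {n : ℕ} {l u v w w' : Fin n → ℂ} (h : (Delta2 l u v).det ≠ 0)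
    (hw : Delta2 l u v *ᵥ w = Delta2 l u v *ᵥ w') : w = w' :=
  mulVec_injective_iff_isUnit.2 ((isUnit_iff_isUnit_det _).2 (isUnit_iff_ne_zero.2 h)) hw

theorem rowCoeff_apply {n : ℕ} (l u v : Fin n → ℂ) (j : Fin n) :
    rowCoeff l u v j
      = -(((Delta2 l u v).updateCol j fun k => l k ^ n * u k).det / (Delta2 l u v).det) := by
  rw [rowCoeff, Pi.neg_apply, Matrix.inv_def, smul_mulVec, ← cramer_eq_adjugate_mulVec,
    Pi.smul_apply, cramer_apply, Ring.inverse_eq_inv', smul_eq_mul, div_eq_inv_mul]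

theorem rowCoeff_zero {n : ℕ} [NeZero n] (l u v : Fin n → ℂ) :
    rowCoeff l u v 0 = -((Delta3 l u v).det / (Delta2 l u v).det) := by
  have h : (Delta2 l u v).updateCol 0 (fun k => l k ^ n * u k) = Delta3 l u v := by
    ext k j
    simp only [updateCol_apply, Delta3, of_apply, Fin.ext_iff, Fin.val_zero]
  rw [rowCoeff_apply, h]

/-- Replacing the last column of `Δ²` by `l ^ n u` gives, up to a cyclic permutation of the
columns, the matrix `Δ¹` with its rows multiplied by the `l k`. -/
theorem rowCoeff_last {m : ℕ} (l u v : Fin (m + 1) → ℂ) :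
    rowCoeff l u v (Fin.last m)
      = -((-1) ^ m * (∏ k, l k) * (Delta2 l v u).det / (Delta2 l u v).det) := by
  rw [rowCoeff_apply]
  congr 2
  have h : ((Delta2 l u v).updateCol (Fin.last m) fun k => l k ^ (m + 1) * u k)
      = (diagonal l * Delta2 l v u).submatrix id (finRotate (m + 1)) := by
    ext k j
    rw [submatrix_apply, diagonal_mul, updateCol_apply, id]
    refine Fin.lastCases ?_ (fun i => ?_) j
    · simp [Delta2, pow_succ']; ring
    · have hi : (i : ℕ) < m := i.2
      have hp : l k ^ (m - i : ℕ) = l k * l k ^ (m - (i + 1) : ℕ) := by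
        rw [← pow_succ']; congr 1; omega
      have hf : finRotate (m + 1) i.castSucc = i.succ := by
        rw [finRotate_apply, Fin.coeSucc_eq_succ]
      rw [hf]
      by_cases he : Even (i : ℕ) <;>
        simp [Delta2, he, Nat.even_add_one, hp, (Fin.castSucc_lt_last i).ne, mul_assoc]
  rw [h, det_permute', det_mul, det_diagonal, sign_finRotate]
  simp [mul_assoc]

theorem bordered_eq {n : ℕ} {l u v : Fin n → ℂ} (h : (Delta2 l u v).det ≠ 0) (c : ℂ)
    (ξ : Fin n → ℂ) :
    bordered c ξ (fun k => l k ^ n * u k) (Delta2 l u v)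
      = (Delta2 l u v).det * (c + ξ ⬝ᵥ rowCoeff l u v) := by
  have hu : IsUnit (Delta2 l u v).det := isUnit_iff_ne_zero.2 h
  let _ := invertibleOfIsUnitDet _ hu
  rw [bordered, det_fromBlocks₂₂, det_unique (n := Unit), rowCoeff, dotProduct_neg,
    invOf_eq_nonsing_inv, dotProduct_mulVec]
  simp only [Matrix.sub_apply, of_apply, mul_apply, replicateRow_apply, replicateCol_apply,
    dotProduct, vecMul, sub_eq_add_neg]

/-! ### The evolution of the coefficients -/

/-- A polynomial `[[P, R], [S, -P]]` in the spectral parameter with `P` even of degree at most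
`4` and with `R`, `S` odd of degree at most `3`; both matrices of the Lax pair have this form. -/
@[ext]
structure LaxPoly where
  (p4 p2 p0 r3 r1 s3 s1 : ℂ)

namespace LaxPoly

/-- The upper left entry. -/
def P (M : LaxPoly) (z : ℂ) : ℂ := M.p4 * z ^ 4 + M.p2 * z ^ 2 + M.p0

/-- The upper right entry. -/
def R (M : LaxPoly) (z : ℂ) : ℂ := M.r3 * z ^ 3 + M.r1 * z

/-- The lower left entry. -/
def S (M : LaxPoly) (z : ℂ) : ℂ := M.s3 * z ^ 3 + M.s1 * z

/-- The value of the polynomial matrix. -/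
def mat (M : LaxPoly) (z : ℂ) : Matrix (Fin 2) (Fin 2) ℂ := !![M.P z, M.R z; M.S z, -M.P z]

/-- Conjugation by the permutation of the two coordinates. -/
def swap (M : LaxPoly) : LaxPoly := ⟨-M.p4, -M.p2, -M.p0, M.s3, M.s1, M.r3, M.r1⟩

variable {n : ℕ} [NeZero n]

/-- The transform of `M` under the monic Darboux matrix with coefficient vectors `x`, `y`:
its coefficients are those for which the terms of degree at least `n` (on the diagonal) and
`n + 1` (off the diagonal) in the intertwining relation cancel. -/
def dress (M : LaxPoly) (x y : Fin n → ℂ) : LaxPoly :=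
  let r3' := M.r3 - 2 * M.p4 * x 0
  let s3' := M.s3 + 2 * M.p4 * y 0
  let p2' := M.p2 + M.s3 * x 0 - r3' * y 0
  let r1' := M.r1 + M.r3 * shift x 0 - r3' * shift y 0 - 2 * M.p4 * shift (shift x) 0
    - (M.p2 + p2') * x 0
  let s1' := M.s1 + M.s3 * shift y 0 - s3' * shift x 0 + 2 * M.p4 * shift (shift y) 0
    + (M.p2 + p2') * y 0
  { p4 := M.p4, r3 := r3', s3 := s3', p2 := p2', r1 := r1', s1 := s1'
    p0 := M.p0 + (M.p2 - p2') * shift x 0 + M.s3 * shift (shift x) 0 + M.s1 * x 0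
      - r3' * shift (shift y) 0 - r1' * y 0 }

/-- The second row of the Darboux matrix is treated as the first one after exchanging the
coordinates. The equality of the constant terms expresses that `M.dress x y` is traceless. -/
theorem swap_dress (M : LaxPoly) (x y : Fin n → ℂ) : M.swap.dress y x = (M.dress x y).swap := by
  ext <;> simp only [dress, swap] <;> ring

/-- The derivative of the coefficient vector `x` along a solution of the linear system with
matrix `M`, where `y` is the coefficient vector of the other row. -/
def flow (M : LaxPoly) (x y : Fin n → ℂ) : Fin n → ℂ :=
  let N := M.dress x y
  fun j => if Even (j : ℕ) then
      (2 * M.p4) * shift (shift (shift (shift x))) j + (M.p2 + N.p2) * shift (shift x) j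
        + (M.p0 + N.p0) * x j - M.r3 * shift (shift (shift x)) j - M.r1 * shift x j
        + N.r3 * shift (shift (shift y)) j + N.r1 * shift y j
    else
      (N.p2 - M.p2) * shift (shift x) j + (N.p0 - M.p0) * x j
        - M.s3 * shift (shift (shift x)) j - M.s1 * shift x j
        + N.r3 * shift (shift (shift y)) j + N.r1 * shift y j

/-- The first entry of the first row of the intertwining relation: what remains of
`T̂ M - (M.dress x y) T̂` after the cancellation of the terms of high degree is `-ξ¹ ⬝ flow`. -/
theorem xi1_dotProduct_flow (M : LaxPoly) (x y : Fin n → ℂ) (z : ℂ) :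
    xi1 n z ⬝ᵥ M.flow x y + (z ^ n + xi1 n z ⬝ᵥ x) * M.P z + (xi2 n z ⬝ᵥ x) * M.S z
      = (M.dress x y).P z * (z ^ n + xi1 n z ⬝ᵥ x) + (M.dress x y).R z * (xi2 n z ⬝ᵥ y) := by
  have hf : xi1 n z ⬝ᵥ M.flow x y = xi1 n z ⬝ᵥ (((M.dress x y).p2 - M.p2) • shift (shift x)
      + ((M.dress x y).p0 - M.p0) • x - M.s3 • shift (shift (shift x)) - M.s1 • shift x
      + (M.dress x y).r3 • shift (shift (shift y)) + (M.dress x y).r1 • shift y) := by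
    refine Finset.sum_congr rfl fun j _ => ?_
    by_cases hj : Even (j : ℕ) <;> simp [xi1, flow, hj]
  simp only [dotProduct_add, dotProduct_sub, dotProduct_smul, smul_eq_mul] at hf
  have h2 := mul_xi2_dotProduct (n := n) z
  have h1 := mul_xi1_dotProduct (n := n) z
  have hp4 : (M.dress x y).p4 = M.p4 := rfl
  have hp2 : (M.dress x y).p2 = M.p2 + M.s3 * x 0 - (M.dress x y).r3 * y 0 := rfl
  have hp0 : (M.dress x y).p0 = M.p0 + (M.p2 - (M.dress x y).p2) * shift x 0
    + M.s3 * shift (shift x) 0 + M.s1 * x 0 - (M.dress x y).r3 * shift (shift y) 0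
    - (M.dress x y).r1 * y 0 := rfl
  rw [hf]
  simp only [P, R, S]
  have a1 : z ^ 2 * (xi1 n z ⬝ᵥ x) = shift x 0 * z ^ n + xi1 n z ⬝ᵥ shift (shift x) := by
    linear_combination z * h1 x + h2 (shift x)
  have c : ∀ w, z ^ 3 * (xi2 n z ⬝ᵥ w) = w 0 * z ^ (n + 2) + shift (shift w) 0 * z ^ n
      + xi1 n z ⬝ᵥ shift (shift (shift w)) := fun w => by
    linear_combination z ^ 2 * h2 w + z * h1 (shift w) + h2 (shift (shift w))
  linear_combination (M.p2 - (M.dress x y).p2) * a1 + M.s3 * c x + M.s1 * h2 x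
    - (M.dress x y).r3 * c y - (M.dress x y).r1 * h2 y - z ^ (n + 2) * hp2 - z ^ n * hp0
    - z ^ 4 * (z ^ n + xi1 n z ⬝ᵥ x) * hp4

/-- The second entry of the first row of the intertwining relation. -/
theorem xi2_dotProduct_flow (M : LaxPoly) (x y : Fin n → ℂ) (z : ℂ) :
    xi2 n z ⬝ᵥ M.flow x y + (z ^ n + xi1 n z ⬝ᵥ x) * M.R z - (xi2 n z ⬝ᵥ x) * M.P z
      = (M.dress x y).P z * (xi2 n z ⬝ᵥ x) + (M.dress x y).R z * (z ^ n + xi1 n z ⬝ᵥ y) := by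
  have hf : xi2 n z ⬝ᵥ M.flow x y = xi2 n z ⬝ᵥ ((2 * M.p4) • shift (shift (shift (shift x)))
      + (M.p2 + (M.dress x y).p2) • shift (shift x)
      + (M.p0 + (M.dress x y).p0) • x - M.r3 • shift (shift (shift x)) - M.r1 • shift x
      + (M.dress x y).r3 • shift (shift (shift y)) + (M.dress x y).r1 • shift y) := by
    refine Finset.sum_congr rfl fun j _ => ?_
    by_cases hj : Even (j : ℕ) <;> simp [xi2, flow, hj]
  simp only [dotProduct_add, dotProduct_sub, dotProduct_smul, smul_eq_mul] at hf
  have h2 := mul_xi2_dotProduct (n := n) z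
  have h1 := mul_xi1_dotProduct (n := n) z
  have hp4 : (M.dress x y).p4 = M.p4 := rfl
  have hr3 : (M.dress x y).r3 = M.r3 - 2 * M.p4 * x 0 := rfl
  have hr1 : (M.dress x y).r1 = M.r1 + M.r3 * shift x 0 - (M.dress x y).r3 * shift y 0
    - 2 * M.p4 * shift (shift x) 0 - (M.p2 + (M.dress x y).p2) * x 0 := rfl
  rw [hf]
  simp only [P, R]
  have b : ∀ w, z ^ 2 * (xi2 n z ⬝ᵥ w) = w 0 * z ^ (n + 1) + xi2 n z ⬝ᵥ shift (shift w) :=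
    fun w => by linear_combination z * h2 w + h1 (shift w)
  have d : ∀ w, z ^ 3 * (xi1 n z ⬝ᵥ w) = shift w 0 * z ^ (n + 1)
      + xi2 n z ⬝ᵥ shift (shift (shift w)) := fun w => by
    linear_combination z ^ 2 * h1 w + b (shift w)
  linear_combination -2 * M.p4 * (z ^ 2 * b x + b (shift (shift x)))
    - (M.p2 + (M.dress x y).p2) * b x + M.r3 * d x + M.r1 * h1 x
    - (M.dress x y).r3 * d y - (M.dress x y).r1 * h1 y - z ^ (n + 3) * hr3 - z ^ (n + 1) * hr1
    - z ^ 4 * (xi2 n z ⬝ᵥ x) * hp4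

end LaxPoly

end

section

/-! ### Derivatives along curves of eigenfunctions -/

/-- The derivative of the determinant at `M` in the direction `N`. -/
def detDeriv {n : ℕ} (M N : Matrix (Fin n) (Fin n) ℂ) : ℂ :=
  ∑ σ : Equiv.Perm (Fin n), (Equiv.Perm.sign σ : ℂ) *
    ∑ i, (∏ j ∈ Finset.univ.erase i, M (σ j) j) * N (σ i) i

theorem hasDerivAt_det {n : ℕ} {M : ℝ → Matrix (Fin n) (Fin n) ℂ} {M' : Matrix (Fin n) (Fin n) ℂ}
    {y : ℝ} (h : ∀ i j, HasDerivAt (fun t => M t i j) (M' i j) y) :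
    HasDerivAt (fun t => (M t).det) (detDeriv (M y) M') y := by
  simp only [det_apply', detDeriv]
  refine HasDerivAt.fun_sum fun σ _ => HasDerivAt.const_mul _ ?_
  have := HasDerivAt.fun_finsetProd (u := Finset.univ) (f := fun i t => M t (σ i) i)
    (f' := fun i => M' (σ i) i) (x := y) fun i _ => h (σ i) i
  simpa only [smul_eq_mul] using this

theorem continuousAt_detDeriv {X : Type*} [TopologicalSpace X] {n : ℕ}
    {M N : X → Matrix (Fin n) (Fin n) ℂ} {p : X}
    (hM : ∀ i j, ContinuousAt (fun t => M t i j) p)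
    (hN : ∀ i j, ContinuousAt (fun t => N t i j) p) :
    ContinuousAt (fun t => detDeriv (M t) (N t)) p := by
  simp only [detDeriv]
  fun_prop

theorem continuousAt_det {X : Type*} [TopologicalSpace X] {n : ℕ}
    {M : X → Matrix (Fin n) (Fin n) ℂ} {p : X} (hM : ∀ i j, ContinuousAt (fun t => M t i j) p) :
    ContinuousAt (fun t => (M t).det) p := by
  simp only [det_apply']
  fun_prop

theorem continuousAt_shift {X : Type*} [TopologicalSpace X] {n : ℕ} {w : X → Fin n → ℂ} {p : X}
    (h : ∀ j, ContinuousAt (fun t => w t j) p) (j : Fin n) :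
    ContinuousAt (fun t => shift (w t) j) p := by
  by_cases hj : (j : ℕ) + 1 < n
  · simpa only [shift, hj, dite_true] using h _
  · simpa only [shift, hj, dite_false] using continuousAt_const

theorem continuousAt_Delta2 {X : Type*} [TopologicalSpace X] {n : ℕ} {l u v : X → Fin n → ℂ}
    {p : X} (hl : ∀ k, ContinuousAt (fun t => l t k) p)
    (hu : ∀ k, ContinuousAt (fun t => u t k) p) (hv : ∀ k, ContinuousAt (fun t => v t k) p)
    (i j : Fin n) : ContinuousAt (fun t => Delta2 (l t) (u t) (v t) i j) p := by
  simp only [Delta2, of_apply]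
  split_ifs <;> fun_prop

theorem continuousAt_rowCoeff {X : Type*} [TopologicalSpace X] {n : ℕ} {l u v : X → Fin n → ℂ}
    {p : X} (hl : ∀ k, ContinuousAt (fun t => l t k) p)
    (hu : ∀ k, ContinuousAt (fun t => u t k) p) (hv : ∀ k, ContinuousAt (fun t => v t k) p)
    (h : (Delta2 (l p) (u p) (v p)).det ≠ 0) (j : Fin n) :
    ContinuousAt (fun t => rowCoeff (l t) (u t) (v t) j) p := by
  simp only [rowCoeff_apply]
  refine ((continuousAt_det fun a b => ?_).div
    (continuousAt_det (continuousAt_Delta2 hl hu hv)) h).neg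
  simp only [updateCol_apply]
  split_ifs
  · fun_prop
  · exact continuousAt_Delta2 hl hu hv a b

theorem hasDerivAt_Delta2 {n : ℕ} {l : Fin n → ℂ} {u v : ℝ → Fin n → ℂ} {u' v' : Fin n → ℂ}
    {y : ℝ} (hu : ∀ k, HasDerivAt (fun t => u t k) (u' k) y)
    (hv : ∀ k, HasDerivAt (fun t => v t k) (v' k) y) (i j : Fin n) :
    HasDerivAt (fun t => Delta2 l (u t) (v t) i j) (Delta2 l u' v' i j) y := by
  simp only [Delta2, of_apply]
  split_ifs
  · exact (hv i).const_mul _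
  · exact (hu i).const_mul _

theorem differentiableAt_rowCoeff {n : ℕ} {l : Fin n → ℂ} {u v : ℝ → Fin n → ℂ} {y : ℝ}
    (hu : ∀ k, DifferentiableAt ℝ (fun t => u t k) y)
    (hv : ∀ k, DifferentiableAt ℝ (fun t => v t k) y)
    (h : (Delta2 l (u y) (v y)).det ≠ 0) (j : Fin n) :
    DifferentiableAt ℝ (fun t => rowCoeff l (u t) (v t) j) y := by
  have hd := hasDerivAt_Delta2 (l := l) (fun k => (hu k).hasDerivAt) fun k => (hv k).hasDerivAt
  have hN := hasDerivAt_det (M := fun t => (Delta2 l (u t) (v t)).updateCol j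
      fun k => l k ^ n * u t k)
    (M' := (Delta2 l (fun k => deriv (fun t => u t k) y)
      fun k => deriv (fun t => v t k) y).updateCol j fun k => l k ^ n * deriv (fun t => u t k) y) (y := y) fun a b => by
    simp only [updateCol_apply]
    split_ifs
    · exact (hu a).hasDerivAt.const_mul _
    · exact hd a b
  simp only [rowCoeff_apply]
  exact (hN.div (hasDerivAt_det hd) h).differentiableAt.neg

namespace LaxPoly

variable {n : ℕ}

/-- At the parameter `y`, each `(u k, v k)` satisfies the linear system with matrix
`M.mat (l k)`. -/
def IsFlowAt (M : LaxPoly) (l : Fin n → ℂ) (u v : ℝ → Fin n → ℂ) (y : ℝ) : Prop :=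
  (∀ k, HasDerivAt (fun t => u t k) (M.P (l k) * u y k + M.R (l k) * v y k) y) ∧
    ∀ k, HasDerivAt (fun t => v t k) (M.S (l k) * u y k - M.P (l k) * v y k) y

theorem IsFlowAt.swap {M : LaxPoly} {l : Fin n → ℂ} {u v : ℝ → Fin n → ℂ} {y : ℝ}
    (h : M.IsFlowAt l u v y) : M.swap.IsFlowAt l v u y := by
  refine ⟨fun k => (h.2 k).congr_deriv ?_, fun k => (h.1 k).congr_deriv ?_⟩ <;>
    simp only [LaxPoly.swap, P, R, S] <;> ring

variable [NeZero n]

/-- Both sides of the asserted identity for the derivative of the coefficient vector agree after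
applying `Δ²`, because the row of the Darboux matrix annihilates `(u k, v k)` along the curve. -/
theorem hasDerivAt_rowCoeff {M : LaxPoly} {l : Fin n → ℂ} {u v : ℝ → Fin n → ℂ} {y : ℝ}
    (h : M.IsFlowAt l u v y) (h2 : (Delta2 l (u y) (v y)).det ≠ 0)
    (h1 : (Delta2 l (v y) (u y)).det ≠ 0) (j : Fin n) :
    HasDerivAt (fun t => rowCoeff l (u t) (v t) j)
      (M.flow (rowCoeff l (u y) (v y)) (rowCoeff l (v y) (u y)) j) y := by
  choose x' hx using fun j => (⟨_, (differentiableAt_rowCoeff (l := l)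
    (fun k => (h.1 k).differentiableAt) (fun k => (h.2 k).differentiableAt) h2 j).hasDerivAt⟩ :
      ∃ a, HasDerivAt (fun t => rowCoeff l (u t) (v t) j) a y)
  suffices x' = M.flow (rowCoeff l (u y) (v y)) (rowCoeff l (v y) (u y)) by
    rw [← this]; exact hx j
  have hdot : ∀ ξ : Fin n → ℂ,
      HasDerivAt (fun t => ξ ⬝ᵥ rowCoeff l (u t) (v t)) (ξ ⬝ᵥ x') y := fun ξ => by
    simp only [dotProduct]
    exact HasDerivAt.fun_sum fun j _ => (hx j).const_mul _
  have hne : ∀ᶠ t in 𝓝 y, (Delta2 l (u t) (v t)).det ≠ 0 :=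
    (continuousAt_det (M := fun t => Delta2 l (u t) (v t)) (continuousAt_Delta2 (l := fun _ => l)
      (fun k => continuousAt_const) (fun k => (h.1 k).continuousAt)
      fun k => (h.2 k).continuousAt)).eventually_ne h2
  refine eq_of_Delta2_mulVec_eq h2 (funext fun k => ?_)
  have hz : HasDerivAt (fun t => (l k ^ n + xi1 n (l k) ⬝ᵥ rowCoeff l (u t) (v t)) * u t k
      + (xi2 n (l k) ⬝ᵥ rowCoeff l (u t) (v t)) * v t k) 0 y :=
    (hasDerivAt_const y (0 : ℂ)).congr_of_eventuallyEq
      (hne.mono fun t ht => rowCoeff_annihilates ht k)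
  have e := hz.unique ((((hdot (xi1 n (l k))).const_add (l k ^ n)).fun_mul (h.1 k)).fun_add
    ((hdot (xi2 n (l k))).fun_mul (h.2 k)))
  have r1 := rowCoeff_annihilates h2 k
  have r2 := rowCoeff_annihilates h1 k
  have f1 := xi1_dotProduct_flow M (rowCoeff l (u y) (v y)) (rowCoeff l (v y) (u y)) (l k)
  have f2 := xi2_dotProduct_flow M (rowCoeff l (u y) (v y)) (rowCoeff l (v y) (u y)) (l k)
  rw [Delta2_mulVec, Delta2_mulVec]
  linear_combination -e - u y k * f1 - v y k * f2
    - (M.dress (rowCoeff l (u y) (v y)) (rowCoeff l (v y) (u y))).P (l k) * r1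
    - (M.dress (rowCoeff l (u y) (v y)) (rowCoeff l (v y) (u y))).R (l k) * r2

/-- The last entry of the coefficient vector satisfies a scalar equation, because its shifts
vanish. -/
theorem flow_last {m : ℕ} (M : LaxPoly) (x y : Fin (m + 1) → ℂ) :
    M.flow x y (Fin.last m)
      = ((M.dress x y).p0 - (-1) ^ (m + 1) * M.p0) * x (Fin.last m) := by
  have hs : ∀ w : Fin (m + 1) → ℂ, shift w (Fin.last m) = 0 := fun w => by simp [shift]
  by_cases hm : Even m
  · simp only [flow, hs, Fin.val_last, hm, if_true, hm.add_one.neg_one_pow]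
    ring
  · simp only [flow, hs, Fin.val_last, hm, if_false,
      (Nat.not_even_iff_odd.1 hm).add_one.neg_one_pow]
    ring

theorem continuousAt_dress_p0 {X : Type*} [TopologicalSpace X] (M : LaxPoly) {x y : X → Fin n → ℂ}
    {p : X} (hx : ∀ j, ContinuousAt (fun t => x t j) p)
    (hy : ∀ j, ContinuousAt (fun t => y t j) p) : ContinuousAt (fun t => (M.dress (x t) (y t)).p0) p := by
  have x0 := hx 0
  have y0 := hy 0
  have x1 := continuousAt_shift hx 0
  have y1 := continuousAt_shift hy 0
  have x2 := continuousAt_shift (continuousAt_shift hx) 0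
  have y2 := continuousAt_shift (continuousAt_shift hy) 0
  simp only [dress]
  fun_prop

/-- The logarithmic derivative of `|Δ²| / |Δ¹|`, written as an identity between polynomials. If no
`l k` vanishes, then the last coefficient of the first row is a nonzero constant times
`|Δ¹| / |Δ²|`, and its evolution gives the identity. If some `l k` vanishes, the identity follows
from the former case by continuity in `l`, as it holds for the numbers `l k + ε` with small
`ε ≠ 0`. -/
theorem detDeriv_Delta2 (M : LaxPoly) (l u v : Fin n → ℂ) (h2 : (Delta2 l u v).det ≠ 0)
    (h1 : (Delta2 l v u).det ≠ 0) :
    detDeriv (Delta2 l u v) (Delta2 l (fun k => M.P (l k) * u k + M.R (l k) * v k)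
        fun k => M.S (l k) * u k - M.P (l k) * v k) * (Delta2 l v u).det
      - (Delta2 l u v).det * detDeriv (Delta2 l v u)
        (Delta2 l (fun k => M.S (l k) * u k - M.P (l k) * v k)
          fun k => M.P (l k) * u k + M.R (l k) * v k)
      = ((-1) ^ n * M.p0 - (M.dress (rowCoeff l u v) (rowCoeff l v u)).p0)
        * (Delta2 l u v).det * (Delta2 l v u).det := by
  have generic : ∀ l : Fin n → ℂ, (∀ k, l k ≠ 0) → (Delta2 l u v).det ≠ 0 →
      (Delta2 l v u).det ≠ 0 →
      detDeriv (Delta2 l u v) (Delta2 l (fun k => M.P (l k) * u k + M.R (l k) * v k)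
          fun k => M.S (l k) * u k - M.P (l k) * v k) * (Delta2 l v u).det
        - (Delta2 l u v).det * detDeriv (Delta2 l v u)
          (Delta2 l (fun k => M.S (l k) * u k - M.P (l k) * v k)
            fun k => M.P (l k) * u k + M.R (l k) * v k)
        = ((-1) ^ n * M.p0 - (M.dress (rowCoeff l u v) (rowCoeff l v u)).p0)
          * (Delta2 l u v).det * (Delta2 l v u).det := by
    intro l hl h2 h1
    obtain ⟨m, rfl⟩ : ∃ m, n = m + 1 := ⟨n - 1, by have := NeZero.ne n; omega⟩
    set u' : Fin (m + 1) → ℂ := fun k => M.P (l k) * u k + M.R (l k) * v k with hu'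
    set v' : Fin (m + 1) → ℂ := fun k => M.S (l k) * u k - M.P (l k) * v k with hv'
    have line : ∀ a b : ℂ, HasDerivAt (fun t : ℝ => a + (t : ℂ) * b) b 0 := fun a b => by
      simpa using ((hasDerivAt_id (0 : ℝ)).ofReal_comp.mul_const b).const_add a
    have hf : M.IsFlowAt l (fun t k => u k + (t : ℂ) * u' k) (fun t k => v k + (t : ℂ) * v' k) 0 :=
      ⟨fun k => by simpa [hu'] using line (u k) (u' k),
        fun k => by simpa [hv'] using line (v k) (v' k)⟩
    have d2 := hasDerivAt_det (hasDerivAt_Delta2 (l := l) (fun k => line (u k) (u' k))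
      fun k => line (v k) (v' k))
    have d1 := hasDerivAt_det (hasDerivAt_Delta2 (l := l) (fun k => line (v k) (v' k))
      fun k => line (u k) (u' k))
    have dx := M.hasDerivAt_rowCoeff hf (by simpa using h2) (by simpa using h1) (Fin.last m)
    have hc : (-1) ^ m * ∏ k, l k ≠ 0 :=
      mul_ne_zero (pow_ne_zero _ (by norm_num)) (Finset.prod_ne_zero_iff.2 fun k _ => hl k)
    simp only [flow_last, rowCoeff_last] at dx
    have e := dx.unique ((d1.const_mul ((-1) ^ m * ∏ k, l k)).div d2 (by simpa using h2)).neg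
    simp only [ofReal_zero, zero_mul, add_zero] at e
    refine mul_left_cancel₀ (right_ne_zero_of_mul hc) ?_
    field_simp at e
    linear_combination -e
  have hε : ∀ k, ContinuousAt (fun ε : ℂ => l k + ε) 0 := fun k => by fun_prop
  have hcu : ∀ k, ContinuousAt (fun _ : ℂ => u k) 0 := fun k => continuousAt_const
  have hcv : ∀ k, ContinuousAt (fun _ : ℂ => v k) 0 := fun k => continuousAt_const
  have hu' : ∀ k, ContinuousAt (fun ε : ℂ => M.P (l k + ε) * u k + M.R (l k + ε) * v k) 0 :=
    fun k => by simp only [P, R]; fun_prop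
  have hv' : ∀ k, ContinuousAt (fun ε : ℂ => M.S (l k + ε) * u k - M.P (l k + ε) * v k) 0 :=
    fun k => by simp only [P, S]; fun_prop
  have c2 := continuousAt_det (continuousAt_Delta2 hε hcu hcv)
  have c1 := continuousAt_det (continuousAt_Delta2 hε hcv hcu)
  have e2 := continuousAt_detDeriv (continuousAt_Delta2 hε hcu hcv) (continuousAt_Delta2 hε hu' hv')
  have e1 := continuousAt_detDeriv (continuousAt_Delta2 hε hcv hcu) (continuousAt_Delta2 hε hv' hu')
  have x0 := continuousAt_rowCoeff hε hcu hcv (by simpa using h2)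
  have y0 := continuousAt_rowCoeff hε hcv hcu (by simpa using h1)
  have hp := continuousAt_dress_p0 M x0 y0
  have hev : ∀ᶠ ε in 𝓝[≠] (0 : ℂ), (∀ k, l k + ε ≠ 0) ∧
      (Delta2 (fun k => l k + ε) u v).det ≠ 0 ∧ (Delta2 (fun k => l k + ε) v u).det ≠ 0 := by
    refine (eventually_all.2 fun k => ?_).and
      (((c2.eventually_ne (by simpa using h2)).filter_mono nhdsWithin_le_nhds).and
        ((c1.eventually_ne (by simpa using h1)).filter_mono nhdsWithin_le_nhds))
    by_cases hk : l k = 0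
    · simpa [hk] using eventually_mem_nhdsWithin (a := (0 : ℂ)) (s := {0}ᶜ)
    · exact ((hε k).eventually_ne (by simpa using hk)).filter_mono nhdsWithin_le_nhds
  have hL := ((e2.mul c1).sub (c2.mul e1)).tendsto.mono_left (nhdsWithin_le_nhds (s := {0}ᶜ))
  have hR := (((continuousAt_const (y := (-1) ^ n * M.p0)).sub hp).mul c2).mul c1 |>.tendsto
    |>.mono_left (nhdsWithin_le_nhds (s := {0}ᶜ))
  have := tendsto_nhds_unique (hL.congr' (hev.mono fun ε h => generic _ h.1 h.2.1 h.2.2)) hR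
  simpa using this

theorem hasDerivAt_det_div_det {M : LaxPoly} {l : Fin n → ℂ} {u v : ℝ → Fin n → ℂ} {y : ℝ}
    (h : M.IsFlowAt l u v y) (h2 : (Delta2 l (u y) (v y)).det ≠ 0)
    (h1 : (Delta2 l (v y) (u y)).det ≠ 0) :
    HasDerivAt (fun t => (Delta2 l (u t) (v t)).det / (Delta2 l (v t) (u t)).det)
      (((-1) ^ n * M.p0 - (M.dress (rowCoeff l (u y) (v y)) (rowCoeff l (v y) (u y))).p0)
        * ((Delta2 l (u y) (v y)).det / (Delta2 l (v y) (u y)).det)) y := by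
  refine ((hasDerivAt_det (hasDerivAt_Delta2 h.1 h.2)).div
    (hasDerivAt_det (hasDerivAt_Delta2 h.2 h.1)) h1).congr_deriv ?_
  rw [M.detDeriv_Delta2 l (u y) (v y) h2 h1]
  field_simp

end LaxPoly

end

section

/-! ### The Lax pair as a polynomial in the spectral parameter -/

/-- The matrix `U` at a point where the potentials have the values `q` and `r`. -/
def laxPolyU (q r : ℂ) : LaxPoly where
  p4 := 0
  p2 := I
  p0 := -I / 2 + I / 4 * (q * r)
  r3 := 0
  r1 := r
  s3 := 0
  s1 := q

/-- The matrix `V` at a point where the potentials have the values `q` and `r` and the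
`x`-derivatives `qx` and `rx`. -/
def laxPolyV (q r qx rx : ℂ) : LaxPoly where
  p4 := -2 * I
  p2 := 2 * I - I * (q * r)
  p0 := -I / 2 - I / 8 * (q ^ 2 * r ^ 2) + 1 / 4 * (r * qx - rx * q)
  r3 := -2 * r
  r1 := r + I * rx - 1 / 2 * (r ^ 2 * q)
  s3 := -2 * q
  s1 := q - I * qx - 1 / 2 * (q ^ 2 * r)

theorem laxU_eq (q r : ℝ × ℝ → ℂ) (z : ℂ) (p : ℝ × ℝ) :
    laxU q r z p = (laxPolyU (q p) (r p)).mat z := by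
  ext i j
  fin_cases i <;> fin_cases j <;>
    simp [laxU, laxPolyU, LaxPoly.mat, LaxPoly.P, LaxPoly.R, LaxPoly.S, sigma3, Qmat,
      pow_two] <;> ring

theorem matDx_Qmat (q r : ℝ × ℝ → ℂ) (p : ℝ × ℝ) :
    matDx (Qmat q r) p = !![0, dx r p; dx q p, 0] := by
  ext i j
  fin_cases i <;> fin_cases j <;> simp [matDx, Qmat, dx]

theorem laxV_eq (q r : ℝ × ℝ → ℂ) (z : ℂ) (p : ℝ × ℝ) :
    laxV q r z p = (laxPolyV (q p) (r p) (dx q p) (dx r p)).mat z := by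
  rw [laxV, matDx_Qmat]
  ext i j
  fin_cases i <;> fin_cases j <;>
    simp [laxPolyV, LaxPoly.mat, LaxPoly.P, LaxPoly.R, LaxPoly.S, sigma3, Qmat, pow_succ] <;> ring

namespace LaxPoly

variable {n : ℕ} [NeZero n]

/-- The transform of `M` under `diag(a, a⁻¹)` times the monic Darboux matrix with coefficient
vectors `x`, `y`, where `a ^ 2 = ρ` and `a` evolves in such a way that the constant term on the
diagonal is the mean of those of `M` and `M.dress x y`. -/
def gauge (M : LaxPoly) (x y : Fin n → ℂ) (ρ : ℂ) : LaxPoly where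
  p4 := M.p4
  p2 := (M.dress x y).p2
  p0 := (M.p0 + (M.dress x y).p0) / 2
  r3 := ρ * (M.dress x y).r3
  r1 := ρ * (M.dress x y).r1
  s3 := (M.dress x y).s3 / ρ
  s1 := (M.dress x y).s1 / ρ

end LaxPoly

variable {n : ℕ} [NeZero n]

theorem laxPolyU_gauge (q r ρ : ℂ) (hρ : ρ ≠ 0) (x y : Fin n → ℂ) :
    (laxPolyU q r).gauge x y ρ
      = laxPolyU ((q + 2 * I * y 0) / ρ) (ρ * (r - 2 * I * x 0)) := by
  ext <;> simp only [laxPolyU, LaxPoly.gauge, LaxPoly.dress] <;> field_simp <;>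
    ring_nf <;> simp only [I_sq, I_pow_three] <;> ring

/-- The coefficients `x 0`, `y 0` and the factor `ρ` evolve in `x` by the flow of `U`, so the
`x`-derivatives of the new potentials involve the same coefficients as the transform of `V`. -/
theorem laxPolyV_gauge (q r qx rx ρ : ℂ) (hρ : ρ ≠ 0) (x y : Fin n → ℂ) :
    (laxPolyV q r qx rx).gauge x y ρ
      = laxPolyV ((q + 2 * I * y 0) / ρ) (ρ * (r - 2 * I * x 0))
        (((qx + 2 * I * (laxPolyU q r).swap.flow y x 0)
          - ((laxPolyU q r).p0 - ((laxPolyU q r).dress x y).p0) * (q + 2 * I * y 0)) / ρ)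
        (ρ * ((rx - 2 * I * (laxPolyU q r).flow x y 0)
          + ((laxPolyU q r).p0 - ((laxPolyU q r).dress x y).p0) * (r - 2 * I * x 0))) := by
  have h0 : Even ((0 : Fin n) : ℕ) := by simp
  have hI : I ^ 5 = I := by rw [pow_succ, I_pow_four, one_mul]
  ext <;> simp only [laxPolyU, laxPolyV, LaxPoly.gauge, LaxPoly.dress, LaxPoly.flow, LaxPoly.swap,
      h0, if_true] <;> field_simp <;>
    ring_nf <;> simp only [I_sq, I_pow_three, I_pow_four, hI] <;> ring

/-! ### Partial derivatives -/

theorem hasDerivAt_dx {u : ℝ × ℝ → ℂ} {p : ℝ × ℝ} (h : DifferentiableAt ℝ u p) :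
    HasDerivAt (fun y : ℝ => u (y, p.2)) (dx u p) p.1 := by
  have : DifferentiableAt ℝ (fun y : ℝ => u (y, p.2)) p.1 :=
    DifferentiableAt.comp p.1 (g := u) (f := fun y : ℝ => (y, p.2)) h (by fun_prop)
  exact this.hasDerivAt

theorem hasDerivAt_dt {u : ℝ × ℝ → ℂ} {p : ℝ × ℝ} (h : DifferentiableAt ℝ u p) :
    HasDerivAt (fun s : ℝ => u (p.1, s)) (dt u p) p.2 := by
  have : DifferentiableAt ℝ (fun s : ℝ => u (p.1, s)) p.2 :=
    DifferentiableAt.comp p.2 (g := u) (f := fun s : ℝ => (p.1, s)) h (by fun_prop)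
  exact this.hasDerivAt

theorem dx_eq_fderiv {u : ℝ × ℝ → ℂ} {p : ℝ × ℝ} (h : DifferentiableAt ℝ u p) :
    dx u p = fderiv ℝ u p (1, 0) := by
  have h1 : HasDerivAt (fun y : ℝ => (y, p.2)) ((1 : ℝ), (0 : ℝ)) p.1 :=
    (hasDerivAt_id _).prodMk (hasDerivAt_const _ _)
  exact (hasDerivAt_dx h).unique
    (HasFDerivAt.comp_hasDerivAt (l := u) p.1 h.hasFDerivAt h1)

theorem dt_eq_fderiv {u : ℝ × ℝ → ℂ} {p : ℝ × ℝ} (h : DifferentiableAt ℝ u p) :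
    dt u p = fderiv ℝ u p (0, 1) := by
  have h1 : HasDerivAt (fun s : ℝ => (p.1, s)) ((0 : ℝ), (1 : ℝ)) p.2 :=
    (hasDerivAt_const _ _).prodMk (hasDerivAt_id _)
  exact (hasDerivAt_dt h).unique
    (HasFDerivAt.comp_hasDerivAt (l := u) p.2 h.hasFDerivAt h1)

theorem dx_eventuallyEq {u : ℝ × ℝ → ℂ} {p : ℝ × ℝ} (h : ContDiffAt ℝ 2 u p) :
    dx u =ᶠ[𝓝 p] fun p' => fderiv ℝ u p' (1, 0) :=
  (h.eventually (by simp)).mono fun _ h' => dx_eq_fderiv (h'.differentiableAt (by simp))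

theorem dt_eventuallyEq {u : ℝ × ℝ → ℂ} {p : ℝ × ℝ} (h : ContDiffAt ℝ 2 u p) :
    dt u =ᶠ[𝓝 p] fun p' => fderiv ℝ u p' (0, 1) :=
  (h.eventually (by simp)).mono fun _ h' => dt_eq_fderiv (h'.differentiableAt (by simp))

theorem differentiableAt_dx {u : ℝ × ℝ → ℂ} {p : ℝ × ℝ} (h : ContDiffAt ℝ 2 u p) :
    DifferentiableAt ℝ (dx u) p := by
  have h1 : ContDiffAt ℝ 1 (fderiv ℝ u) p := h.fderiv_right (by norm_num)
  exact ((h1.differentiableAt (by simp)).clm_apply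
    (differentiableAt_const _)).congr_of_eventuallyEq (dx_eventuallyEq h)

theorem tendsto_slice_x (p : ℝ × ℝ) : Tendsto (fun y : ℝ => (y, p.2)) (𝓝 p.1) (𝓝 p) :=
  (Continuous.prodMk_left p.2).tendsto p.1

theorem tendsto_slice_t (p : ℝ × ℝ) : Tendsto (fun s : ℝ => (p.1, s)) (𝓝 p.2) (𝓝 p) :=
  (Continuous.prodMk_right p.1).tendsto p.2

theorem dx_congr {u v : ℝ × ℝ → ℂ} {p : ℝ × ℝ} (h : u =ᶠ[𝓝 p] v) : dx u p = dx v p :=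
  (h.comp_tendsto (tendsto_slice_x p)).deriv_eq

theorem dt_congr {u v : ℝ × ℝ → ℂ} {p : ℝ × ℝ} (h : u =ᶠ[𝓝 p] v) : dt u p = dt v p :=
  (h.comp_tendsto (tendsto_slice_t p)).deriv_eq

theorem dx_dt_comm {u : ℝ × ℝ → ℂ} {p : ℝ × ℝ} (h : ContDiffAt ℝ 2 u p) :
    dx (dt u) p = dt (dx u) p := by
  have h1 : ContDiffAt ℝ 1 (fderiv ℝ u) p := h.fderiv_right (by norm_num)
  have hd := h1.differentiableAt (by simp)
  have hs : IsSymmSndFDerivAt ℝ u p := h.isSymmSndFDerivAt (by simp)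
  have key : ∀ e : ℝ × ℝ, HasFDerivAt (fun p' => fderiv ℝ u p' e)
      ((fderiv ℝ (fderiv ℝ u) p).flip e) p := fun e => by
    simpa using hd.hasFDerivAt.clm_apply (hasFDerivAt_const e p)
  rw [dx_congr (dt_eventuallyEq h), dt_congr (dx_eventuallyEq h),
    dx_eq_fderiv (key _).differentiableAt, dt_eq_fderiv (key _).differentiableAt,
    (key _).fderiv, (key _).fderiv]
  simpa using hs.eq (1, 0) (0, 1)

/-! ### Compatibility of intertwining relations -/

/-- Entrywise differentiability of a matrix-valued curve, with derivative `N`. -/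
def HasMatDerivAt (M : ℝ → Matrix (Fin 2) (Fin 2) ℂ) (N : Matrix (Fin 2) (Fin 2) ℂ) (y : ℝ) :
    Prop :=
  ∀ i j, HasDerivAt (fun t => M t i j) (N i j) y

theorem HasMatDerivAt.mul {A B : ℝ → Matrix (Fin 2) (Fin 2) ℂ} {A' B' : Matrix (Fin 2) (Fin 2) ℂ}
    {y : ℝ} (hA : HasMatDerivAt A A' y) (hB : HasMatDerivAt B B' y) :
    HasMatDerivAt (fun t => A t * B t) (A' * B y + A y * B') y := fun i j => by
  simp only [Matrix.mul_apply, Matrix.add_apply, ← Finset.sum_add_distrib]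
  exact HasDerivAt.fun_sum fun k _ => (hA i k).mul (hB k j)

theorem HasMatDerivAt.sub {A B : ℝ → Matrix (Fin 2) (Fin 2) ℂ} {A' B' : Matrix (Fin 2) (Fin 2) ℂ}
    {y : ℝ} (hA : HasMatDerivAt A A' y) (hB : HasMatDerivAt B B' y) :
    HasMatDerivAt (fun t => A t - B t) (A' - B') y := fun i j =>
  (hA i j).sub (hB i j)

/-- If `T` intertwines `(U, V)` with `(U', V')`, then it intertwines their curvatures, by the
equality of the mixed partial derivatives of `T`. -/
theorem curvature_intertwine {T U V U' V' : ℝ × ℝ → Matrix (Fin 2) (Fin 2) ℂ} {p : ℝ × ℝ}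
    {Ut Vx U't V'x : Matrix (Fin 2) (Fin 2) ℂ}
    (hT : ∀ i j, ContDiffAt ℝ 2 (fun p' => T p' i j) p)
    (hx : ∀ᶠ p' in 𝓝 p,
      HasMatDerivAt (fun y => T (y, p'.2)) (U' p' * T p' - T p' * U p') p'.1)
    (ht : ∀ᶠ p' in 𝓝 p,
      HasMatDerivAt (fun s => T (p'.1, s)) (V' p' * T p' - T p' * V p') p'.2)
    (hU : HasMatDerivAt (fun s => U (p.1, s)) Ut p.2)
    (hU' : HasMatDerivAt (fun s => U' (p.1, s)) U't p.2)
    (hV : HasMatDerivAt (fun y => V (y, p.2)) Vx p.1)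
    (hV' : HasMatDerivAt (fun y => V' (y, p.2)) V'x p.1) :
    (U't - V'x + U' p * V' p - V' p * U' p) * T p
      = T p * (Ut - Vx + U p * V p - V p * U p) := by
  have hxt := (hU'.mul ht.self_of_nhds).sub (ht.self_of_nhds.mul hU)
  have htx := (hV'.mul hx.self_of_nhds).sub (hx.self_of_nhds.mul hV)
  have key : (V'x * T p + V' p * (U' p * T p - T p * U p)
      - ((U' p * T p - T p * U p) * V p + T p * Vx))
      = (U't * T p + U' p * (V' p * T p - T p * V p)
      - ((V' p * T p - T p * V p) * U p + T p * Ut)) := by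
    ext i j
    have e1 : dx (fun p' => T p' i j) =ᶠ[𝓝 p] fun p' => (U' p' * T p' - T p' * U p') i j :=
      hx.mono fun p' h => (h i j).deriv
    have e2 : dt (fun p' => T p' i j) =ᶠ[𝓝 p] fun p' => (V' p' * T p' - T p' * V p') i j :=
      ht.mono fun p' h => (h i j).deriv
    have c := dx_dt_comm (hT i j)
    rw [dx_congr e2, dt_congr e1] at c
    exact ((htx i j).deriv.symm.trans c).trans (hxt i j).deriv
  rw [← sub_eq_zero] at key ⊢
  rw [← neg_eq_zero, ← key]
  noncomm_ring

/-- The derivative of `(laxPolyU q r).mat z` when `q`, `r` have the derivatives `q'`, `r'`. -/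
def laxPolyUDeriv (q r q' r' z : ℂ) : Matrix (Fin 2) (Fin 2) ℂ :=
  !![I / 4 * (q' * r + q * r'), r' * z; q' * z, -(I / 4 * (q' * r + q * r'))]

/-- The derivative of `(laxPolyV q r qx rx).mat z` when `q`, `r`, `qx`, `rx` have the derivatives
`q'`, `r'`, `qx'`, `rx'`. -/
def laxPolyVDeriv (q r qx rx q' r' qx' rx' z : ℂ) : Matrix (Fin 2) (Fin 2) ℂ :=
  !![-I * (q' * r + q * r') * z ^ 2 - I / 4 * (q * r * (q' * r + q * r'))
      + 1 / 4 * (r' * qx + r * qx' - (rx' * q + rx * q')),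
    -2 * r' * z ^ 3 + (r' + I * rx' - 1 / 2 * (2 * r * r' * q + r ^ 2 * q')) * z;
    -2 * q' * z ^ 3 + (q' - I * qx' - 1 / 2 * (2 * q * q' * r + q ^ 2 * r')) * z,
    -(-I * (q' * r + q * r') * z ^ 2 - I / 4 * (q * r * (q' * r + q * r'))
      + 1 / 4 * (r' * qx + r * qx' - (rx' * q + rx * q')))]

theorem hasMatDerivAt_laxPolyU {q r : ℝ → ℂ} {q' r' : ℂ} {y : ℝ} (hq : HasDerivAt q q' y)
    (hr : HasDerivAt r r' y) (z : ℂ) :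
    HasMatDerivAt (fun t => (laxPolyU (q t) (r t)).mat z)
      (laxPolyUDeriv (q y) (r y) q' r' z) y := by
  have h : HasDerivAt (fun t => (laxPolyU (q t) (r t)).P z)
      (I / 4 * (q' * r y + q y * r')) y := by
    simp only [laxPolyU, LaxPoly.P]
    exact ((((hq.fun_mul hr).const_mul (I / 4)).const_add (-I / 2)).const_add
      (0 * z ^ 4 + I * z ^ 2))
  intro i j
  fin_cases i <;> fin_cases j <;> simp only [LaxPoly.mat, laxPolyUDeriv]
  · exact h
  · simpa [laxPolyU, LaxPoly.R] using hr.mul_const z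
  · simpa [laxPolyU, LaxPoly.S] using hq.mul_const z
  · exact h.neg

theorem hasMatDerivAt_laxPolyV {q r qx rx : ℝ → ℂ} {q' r' qx' rx' : ℂ} {y : ℝ}
    (hq : HasDerivAt q q' y) (hr : HasDerivAt r r' y) (hqx : HasDerivAt qx qx' y)
    (hrx : HasDerivAt rx rx' y) (z : ℂ) :
    HasMatDerivAt (fun t => (laxPolyV (q t) (r t) (qx t) (rx t)).mat z)
      (laxPolyVDeriv (q y) (r y) (qx y) (rx y) q' r' qx' rx' z) y := by
  have h : HasDerivAt (fun t => (laxPolyV (q t) (r t) (qx t) (rx t)).P z)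
      (-I * (q' * r y + q y * r') * z ^ 2 - I / 4 * (q y * r y * (q' * r y + q y * r'))
        + 1 / 4 * (r' * qx y + r y * qx' - (rx' * q y + rx y * q'))) y := by
    simp only [laxPolyV, LaxPoly.P]
    have h1 := ((((hq.fun_mul hr).const_mul I).const_sub (2 * I)).mul_const (z ^ 2)).const_add
      (-2 * I * z ^ 4)
    have h2 := (((hq.fun_pow 2).fun_mul (hr.fun_pow 2)).const_mul (I / 8)).const_sub (-I / 2)
    have h3 := ((hr.fun_mul hqx).fun_sub (hrx.fun_mul hq)).const_mul (1 / 4)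
    refine (h1.fun_add (h2.fun_add h3)).congr_deriv ?_
    push_cast
    ring
  have hR : HasDerivAt (fun t => (laxPolyV (q t) (r t) (qx t) (rx t)).R z)
      (-2 * r' * z ^ 3 + (r' + I * rx' - 1 / 2 * (2 * r y * r' * q y + r y ^ 2 * q')) * z) y := by
    simp only [laxPolyV, LaxPoly.R]
    refine (((hr.const_mul (-2)).mul_const (z ^ 3)).fun_add (((hr.fun_add (hrx.const_mul I)).fun_sub
      (((hr.fun_pow 2).fun_mul hq).const_mul (1 / 2))).mul_const z)).congr_deriv ?_
    push_cast
    ring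
  have hS : HasDerivAt (fun t => (laxPolyV (q t) (r t) (qx t) (rx t)).S z)
      (-2 * q' * z ^ 3 + (q' - I * qx' - 1 / 2 * (2 * q y * q' * r y + q y ^ 2 * r')) * z) y := by
    simp only [laxPolyV, LaxPoly.S]
    refine (((hq.const_mul (-2)).mul_const (z ^ 3)).fun_add (((hq.fun_sub (hqx.const_mul I)).fun_sub
      (((hq.fun_pow 2).fun_mul hr).const_mul (1 / 2))).mul_const z)).congr_deriv ?_
    push_cast
    ring
  intro i j
  fin_cases i <;> fin_cases j <;> simp only [LaxPoly.mat, laxPolyVDeriv]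
  · exact h
  · exact hR
  · exact hS
  · exact h.neg

/-- The curvature `U_t - V_x + [U, V]` in terms of the left-hand sides of the two equations of
the system. -/
theorem curvature_eq (q r qx rx qxx rxx qt rt z : ℂ) :
    laxPolyUDeriv q r qt rt z - laxPolyVDeriv q r qx rx qx rx qxx rxx z
      + (laxPolyU q r).mat z * (laxPolyV q r qx rx).mat z
      - (laxPolyV q r qx rx).mat z * (laxPolyU q r).mat z
      = !![I / 4 * (q * (rt - I * rxx + I * r ^ 2 * q + r * q * rx)
            + r * (qt + I * qxx - I * q ^ 2 * r + q * r * qx)),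
          z * (rt - I * rxx + I * r ^ 2 * q + r * q * rx);
          z * (qt + I * qxx - I * q ^ 2 * r + q * r * qx),
          -(I / 4 * (q * (rt - I * rxx + I * r ^ 2 * q + r * q * rx)
            + r * (qt + I * qxx - I * q ^ 2 * r + q * r * qx)))] := by
  ext i j
  fin_cases i <;> fin_cases j <;>
    simp [laxPolyUDeriv, laxPolyVDeriv, laxPolyU, laxPolyV, LaxPoly.mat, LaxPoly.P, LaxPoly.R,
      LaxPoly.S] <;>
    ring_nf <;> simp only [I_sq] <;> ring

end

section

/-! ### The normalized Darboux matrix -/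

/-- `diag(a, a⁻¹)` times the monic Darboux matrix with coefficient vectors `x` and `y`. -/
def dressing {n : ℕ} (x y : Fin n → ℂ) (a z : ℂ) : Matrix (Fin 2) (Fin 2) ℂ :=
  !![a * (z ^ n + xi1 n z ⬝ᵥ x), a * (xi2 n z ⬝ᵥ x);
    a⁻¹ * (xi2 n z ⬝ᵥ y), a⁻¹ * (z ^ n + xi1 n z ⬝ᵥ y)]

theorem dressing_mulVec {n : ℕ} {l u v : Fin n → ℂ} (h2 : (Delta2 l u v).det ≠ 0)
    (h1 : (Delta2 l v u).det ≠ 0) (a : ℂ) (k : Fin n) :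
    dressing (rowCoeff l u v) (rowCoeff l v u) a (l k) *ᵥ ![u k, v k] = 0 := by
  have e1 := rowCoeff_annihilates h2 k
  have e2 := rowCoeff_annihilates h1 k
  ext i
  fin_cases i <;> simp only [dressing] <;> simp
  · linear_combination a * e1
  · linear_combination a⁻¹ * e2

/-- With `w = z⁻¹`, the function `w ^ (2 n) det` is a polynomial in `w` with value `1` at `0`. -/
theorem exists_det_dressing_ne_zero {n : ℕ} (x y : Fin n → ℂ) {a : ℂ} (ha : a ≠ 0) :
    ∃ z : ℂ, z ≠ 0 ∧ (dressing x y a z).det ≠ 0 := by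
  let e1 : (Fin n → ℂ) → ℂ → ℂ := fun c w =>
    ∑ j : Fin n, (if Even (j : ℕ) then 0 else w ^ (j + 1 : ℕ)) * c j
  let e2 : (Fin n → ℂ) → ℂ → ℂ := fun c w =>
    ∑ j : Fin n, (if Even (j : ℕ) then w ^ (j + 1 : ℕ) else 0) * c j
  have h1 : ∀ c w, w ≠ 0 → w ^ n * (xi1 n w⁻¹ ⬝ᵥ c) = e1 c w := fun c w hw => by
    simp only [dotProduct, Finset.mul_sum, e1, xi1]
    refine Finset.sum_congr rfl fun j _ => ?_
    split_ifs
    · simp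
    · have : w ^ n = w ^ (j + 1 : ℕ) * w ^ (n - 1 - j : ℕ) := by rw [← pow_add]; congr 1; omega
      rw [this, inv_pow]
      field_simp
  have h2 : ∀ c w, w ≠ 0 → w ^ n * (xi2 n w⁻¹ ⬝ᵥ c) = e2 c w := fun c w hw => by
    simp only [dotProduct, Finset.mul_sum, e2, xi2]
    refine Finset.sum_congr rfl fun j _ => ?_
    split_ifs
    · have : w ^ n = w ^ (j + 1 : ℕ) * w ^ (n - 1 - j : ℕ) := by rw [← pow_add]; congr 1; omega
      rw [this, inv_pow]
      field_simp
    · simp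
  have c1 : ∀ c, Continuous (e1 c) := fun c => by
    refine continuous_finsetSum _ fun j _ => ?_
    split_ifs <;> fun_prop
  have c2 : ∀ c, Continuous (e2 c) := fun c => by
    refine continuous_finsetSum _ fun j _ => ?_
    split_ifs <;> fun_prop
  have z1 : ∀ c, e1 c 0 = 0 := fun c => by simp [e1]
  have z2 : ∀ c, e2 c 0 = 0 := fun c => by simp [e2]
  have hF : Continuous fun w => (1 + e1 x w) * (1 + e1 y w) - e2 x w * e2 y w :=
    ((continuous_const.add (c1 x)).mul (continuous_const.add (c1 y))).sub ((c2 x).mul (c2 y))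
  have hev : ∀ᶠ w in 𝓝[≠] (0 : ℂ), (1 + e1 x w) * (1 + e1 y w) - e2 x w * e2 y w ≠ 0 :=
    (hF.continuousAt.eventually_ne (by simp [z1, z2])).filter_mono nhdsWithin_le_nhds
  obtain ⟨w, hw, hw0⟩ := (hev.and eventually_mem_nhdsWithin).exists
  have hw0 : w ≠ 0 := hw0
  refine ⟨w⁻¹, inv_ne_zero hw0, fun hdet => hw ?_⟩
  rw [dressing, det_fin_two_of] at hdet
  have hn : w ^ n * w⁻¹ ^ n = 1 := by rw [← mul_pow, mul_inv_cancel₀ hw0, one_pow]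
  have hdet' : (w⁻¹ ^ n + xi1 n w⁻¹ ⬝ᵥ x) * (w⁻¹ ^ n + xi1 n w⁻¹ ⬝ᵥ y)
      - (xi2 n w⁻¹ ⬝ᵥ x) * (xi2 n w⁻¹ ⬝ᵥ y) = 0 := by
    linear_combination hdet - ((w⁻¹ ^ n + xi1 n w⁻¹ ⬝ᵥ x) * (w⁻¹ ^ n + xi1 n w⁻¹ ⬝ᵥ y)
      - (xi2 n w⁻¹ ⬝ᵥ x) * (xi2 n w⁻¹ ⬝ᵥ y)) * mul_inv_cancel₀ ha
  rw [← h1 _ _ hw0, ← h1 _ _ hw0, ← h2 _ _ hw0, ← h2 _ _ hw0, ← hn]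
  linear_combination (w ^ n) ^ 2 * hdet'

variable {n : ℕ} [NeZero n]

namespace LaxPoly

theorem swap_P (M : LaxPoly) (z : ℂ) : M.swap.P z = -M.P z := by
  simp only [P, swap]; ring

theorem swap_R (M : LaxPoly) (z : ℂ) : M.swap.R z = M.S z := rfl

theorem swap_S (M : LaxPoly) (z : ℂ) : M.swap.S z = M.R z := rfl

theorem gauge_P (M : LaxPoly) (x y : Fin n → ℂ) (ρ z : ℂ) :
    (M.gauge x y ρ).P z = (M.dress x y).P z + (M.p0 - (M.dress x y).p0) / 2 := by
  simp only [P, gauge, dress]; ring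

theorem gauge_R (M : LaxPoly) (x y : Fin n → ℂ) (ρ z : ℂ) :
    (M.gauge x y ρ).R z = ρ * (M.dress x y).R z := by
  simp only [R, gauge]; ring

theorem gauge_S (M : LaxPoly) (x y : Fin n → ℂ) (ρ z : ℂ) :
    (M.gauge x y ρ).S z = ρ⁻¹ * (M.dress x y).S z := by
  simp only [S, gauge]; ring

end LaxPoly

/-- The equation for `ρ = a ^ 2` makes the constant terms on the diagonal match, as
`a' / a = (p0 - p0') / 2` in terms of the constant terms `p0`, `p0'` of `M` and `M.dress x y`. -/
theorem hasMatDerivAt_dressing {M : LaxPoly} {l : Fin n → ℂ} {u v : ℝ → Fin n → ℂ}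
    {ρ a : ℝ → ℂ} {y : ℝ} (h : M.IsFlowAt l u v y) (h2 : (Delta2 l (u y) (v y)).det ≠ 0)
    (h1 : (Delta2 l (v y) (u y)).det ≠ 0)
    (hρ : HasDerivAt ρ
      ((M.p0 - (M.dress (rowCoeff l (u y) (v y)) (rowCoeff l (v y) (u y))).p0) * ρ y) y)
    (hρ0 : ρ y ≠ 0) (ha : DifferentiableAt ℝ a y) (haρ : ∀ᶠ t in 𝓝 y, a t ^ 2 = ρ t) (z : ℂ) :
    HasMatDerivAt (fun t => dressing (rowCoeff l (u t) (v t)) (rowCoeff l (v t) (u t)) (a t) z)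
      ((M.gauge (rowCoeff l (u y) (v y)) (rowCoeff l (v y) (u y)) (ρ y)).mat z
          * dressing (rowCoeff l (u y) (v y)) (rowCoeff l (v y) (u y)) (a y) z
        - dressing (rowCoeff l (u y) (v y)) (rowCoeff l (v y) (u y)) (a y) z * M.mat z) y := by
  have hx := M.hasDerivAt_rowCoeff h h2 h1
  have hy := M.swap.hasDerivAt_rowCoeff h.swap h1 h2
  have ha2 : a y ^ 2 = ρ y := haρ.self_of_nhds
  have ha0 : a y ≠ 0 := fun h0 => hρ0 (by rw [← ha2, h0]; simp)
  rw [← ha2] at hρ ⊢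
  generalize hX : rowCoeff l (u y) (v y) = X at *
  generalize hY : rowCoeff l (v y) (u y) = Y at *
  have f1 := M.xi1_dotProduct_flow X Y z
  have f2 := M.xi2_dotProduct_flow X Y z
  have g1 := M.swap.xi1_dotProduct_flow Y X z
  have g2 := M.swap.xi2_dotProduct_flow Y X z
  simp only [LaxPoly.swap_dress, LaxPoly.swap_P, LaxPoly.swap_R, LaxPoly.swap_S] at g1 g2
  have i1 : a y ^ 2 * (a y)⁻¹ = a y := by field_simp
  have i2 : (a y ^ 2)⁻¹ * a y = (a y)⁻¹ := by field_simp
  have hda : HasDerivAt a ((M.p0 - (M.dress X Y).p0) / 2 * a y) y := by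
    refine ha.hasDerivAt.congr_deriv (mul_left_cancel₀ (mul_ne_zero two_ne_zero ha0) ?_)
    have := ((ha.hasDerivAt.fun_pow 2).congr_of_eventuallyEq
      (haρ.mono fun _ h => h.symm)).unique hρ
    push_cast at this
    linear_combination this
  have hdi : HasDerivAt (fun t => (a t)⁻¹) (-((M.p0 - (M.dress X Y).p0) / 2 * (a y)⁻¹)) y := by
    refine (hda.fun_inv ha0).congr_deriv ?_
    field_simp
  have hdot : ∀ (ξ w' : Fin n → ℂ) (w : ℝ → Fin n → ℂ),
      (∀ j, HasDerivAt (fun t => w t j) (w' j) y) →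
        HasDerivAt (fun t => ξ ⬝ᵥ w t) (ξ ⬝ᵥ w') y := fun ξ w' w hw => by
    simp only [dotProduct]
    exact HasDerivAt.fun_sum fun j _ => (hw j).const_mul _
  have x1 := hdot (xi1 n z) _ _ hx
  have x2 := hdot (xi2 n z) _ _ hx
  have y1 := hdot (xi1 n z) _ _ hy
  have y2 := hdot (xi2 n z) _ _ hy
  intro i j
  fin_cases i <;> fin_cases j
  · refine (hda.mul (x1.const_add (z ^ n))).congr_deriv ?_
    simp [hX, dressing, LaxPoly.mat, LaxPoly.gauge_P, LaxPoly.gauge_R]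
    linear_combination a y * f1 - (M.dress X Y).R z * (xi2 n z ⬝ᵥ Y) * i1
  · refine (hda.mul x2).congr_deriv ?_
    simp [hX, dressing, LaxPoly.mat, LaxPoly.gauge_P, LaxPoly.gauge_R]
    linear_combination a y * f2 - (M.dress X Y).R z * (z ^ n + xi1 n z ⬝ᵥ Y) * i1
  · refine (hdi.mul y2).congr_deriv ?_
    simp [hY, dressing, LaxPoly.mat, LaxPoly.gauge_P, LaxPoly.gauge_S]
    linear_combination (a y)⁻¹ * g2 - (M.dress X Y).S z * (z ^ n + xi1 n z ⬝ᵥ X) * i2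
  · refine (hdi.mul (y1.const_add (z ^ n))).congr_deriv ?_
    simp [hY, dressing, LaxPoly.mat, LaxPoly.gauge_P, LaxPoly.gauge_S]
    linear_combination (a y)⁻¹ * g1 - (M.dress X Y).S z * (xi2 n z ⬝ᵥ X) * i2

end

section

/-! ### The transformed potentials -/

variable {n : ℕ}

/-- The coefficient vector of the first row of the Darboux matrix at a point; `coeffs l g f` is
that of the second row. -/
def coeffs (l : Fin n → ℂ) (f g : Fin n → ℝ × ℝ → ℂ) (p : ℝ × ℝ) : Fin n → ℂ :=
  rowCoeff l (fun k => f k p) (fun k => g k p)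

/-- The square of the factor `a` with which the monic first row of the Darboux matrix has to be
multiplied (the second row is multiplied by `a⁻¹`). -/
def gaugeSq (l : Fin n → ℂ) (f g : Fin n → ℝ × ℝ → ℂ) (H : ℝ × ℝ → ℂ) (p : ℝ × ℝ) : ℂ :=
  (if Even n then 1 else H p) * (det2 l f g p / det1 l f g p)

theorem gaugeSq_ne_zero {l : Fin n → ℂ} {f g : Fin n → ℝ × ℝ → ℂ} {H : ℝ × ℝ → ℂ} {p : ℝ × ℝ}
    (hH : H p ≠ 0) (h1 : det1 l f g p ≠ 0) (h2 : det2 l f g p ≠ 0) : gaugeSq l f g H p ≠ 0 := by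
  refine mul_ne_zero ?_ (div_ne_zero h2 h1)
  split_ifs
  exacts [one_ne_zero, hH]

theorem rn_eq [NeZero n] {l : Fin n → ℂ} {f g : Fin n → ℝ × ℝ → ℂ} {r H : ℝ × ℝ → ℂ} {p : ℝ × ℝ}
    (h1 : det1 l f g p ≠ 0) (h2 : det2 l f g p ≠ 0) :
    rn l f g r H p = gaugeSq l f g H p * (r p - 2 * I * coeffs l f g p 0) := by
  have h0 : coeffs l f g p 0 = -(det3 l f g p / det2 l f g p) := rowCoeff_zero _ _ _
  simp only [rn, gaugeSq, h0]
  split_ifs <;> field_simp <;> ring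

theorem qn_eq [NeZero n] {l : Fin n → ℂ} {f g : Fin n → ℝ × ℝ → ℂ} {q H : ℝ × ℝ → ℂ} {p : ℝ × ℝ}
    (hH : H p ≠ 0) (h1 : det1 l f g p ≠ 0) (h2 : det2 l f g p ≠ 0) :
    qn l f g q H p = (q p + 2 * I * coeffs l g f p 0) / gaugeSq l f g H p := by
  have h0 : coeffs l g f p 0 = -(det4 l f g p / det1 l f g p) := rowCoeff_zero _ _ _
  simp only [qn, gaugeSq, h0]
  split_ifs <;> field_simp <;> ring

theorem contDiffAt_det {m : WithTop ℕ∞} {M : ℝ × ℝ → Matrix (Fin n) (Fin n) ℂ} {p : ℝ × ℝ}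
    (h : ∀ i j, ContDiffAt ℝ m (fun p' => M p' i j) p) :
    ContDiffAt ℝ m (fun p' => (M p').det) p := by
  simp only [det_apply']
  exact ContDiffAt.sum fun σ _ => contDiffAt_const.mul (contDiffAt_prod fun i _ => h _ _)

theorem contDiffAt_Delta2 {m : WithTop ℕ∞} {l : Fin n → ℂ} {f g : Fin n → ℝ × ℝ → ℂ} {p : ℝ × ℝ}
    (hf : ∀ k, ContDiffAt ℝ m (f k) p) (hg : ∀ k, ContDiffAt ℝ m (g k) p) (i j : Fin n) :
    ContDiffAt ℝ m (fun p' => Delta2 l (fun k => f k p') (fun k => g k p') i j) p := by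
  simp only [Delta2, of_apply]
  split_ifs
  · exact contDiffAt_const.mul (hg i)
  · exact contDiffAt_const.mul (hf i)

theorem contDiffAt_coeffs {m : WithTop ℕ∞} {l : Fin n → ℂ} {f g : Fin n → ℝ × ℝ → ℂ} {p : ℝ × ℝ}
    (hf : ∀ k, ContDiffAt ℝ m (f k) p) (hg : ∀ k, ContDiffAt ℝ m (g k) p)
    (h : det2 l f g p ≠ 0) (j : Fin n) : ContDiffAt ℝ m (fun p' => coeffs l f g p' j) p := by
  simp only [coeffs, rowCoeff_apply, div_eq_mul_inv]
  refine ((contDiffAt_det fun a b => ?_).mul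
    ((contDiffAt_det (contDiffAt_Delta2 hf hg)).inv h)).neg
  simp only [updateCol_apply]
  split_ifs
  · exact contDiffAt_const.mul (hf a)
  · exact contDiffAt_Delta2 hf hg a b

theorem contDiffAt_gaugeSq {m : WithTop ℕ∞} {l : Fin n → ℂ} {f g : Fin n → ℝ × ℝ → ℂ}
    {H : ℝ × ℝ → ℂ} {p : ℝ × ℝ} (hf : ∀ k, ContDiffAt ℝ m (f k) p)
    (hg : ∀ k, ContDiffAt ℝ m (g k) p) (hH : ContDiffAt ℝ m H p) (h : det1 l f g p ≠ 0) :
    ContDiffAt ℝ m (gaugeSq l f g H) p := by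
  unfold gaugeSq
  simp only [div_eq_mul_inv]
  refine ContDiffAt.mul ?_ ((contDiffAt_det (contDiffAt_Delta2 hf hg)).mul
    ((contDiffAt_det (contDiffAt_Delta2 hg hf)).inv h))
  split_ifs
  exacts [contDiffAt_const, hH]

theorem exists_local_sqrt {ρ : ℝ × ℝ → ℂ} {p : ℝ × ℝ} {m : WithTop ℕ∞} (h : ContDiffAt ℝ m ρ p)
    (h0 : ρ p ≠ 0) :
    ∃ a : ℝ × ℝ → ℂ, ContDiffAt ℝ m a p ∧ ∀ᶠ p' in 𝓝 p, a p' ^ 2 = ρ p' := by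
  obtain ⟨c, hc⟩ := IsAlgClosed.exists_pow_nat_eq (ρ p) (n := 2) (by norm_num)
  have hs : ρ p / ρ p ∈ slitPlane := by rw [div_self h0]; exact one_mem_slitPlane
  have hl : ContDiffAt ℝ m (fun p' => Complex.log (ρ p' / ρ p)) p :=
    ((contDiffAt_log hs).restrict_scalars ℝ).comp (f := fun p' => ρ p' / ρ p) p
      (by simpa only [div_eq_mul_inv] using h.mul contDiffAt_const)
  refine ⟨fun p' => c * Complex.exp (Complex.log (ρ p' / ρ p) * (1 / 2)),
    contDiffAt_const.mul (hl.mul contDiffAt_const).cexp, ?_⟩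
  filter_upwards [h.continuousAt.eventually_ne h0] with p' hp'
  rw [mul_pow, ← Complex.exp_nat_mul, hc]
  have : ((2 : ℕ) : ℂ) * (Complex.log (ρ p' / ρ p) * (1 / 2)) = Complex.log (ρ p' / ρ p) := by
    push_cast; ring
  rw [this, Complex.exp_log (div_ne_zero hp' h0), mul_div_cancel₀ _ h0]

theorem contDiffAt_dressing {m : WithTop ℕ∞} {p : ℝ × ℝ} {x y : ℝ × ℝ → Fin n → ℂ} {a : ℝ × ℝ → ℂ}
    (hx : ∀ j, ContDiffAt ℝ m (fun p' => x p' j) p) (hy : ∀ j, ContDiffAt ℝ m (fun p' => y p' j) p)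
    (ha : ContDiffAt ℝ m a p) (ha0 : a p ≠ 0) (z : ℂ) (i j : Fin 2) :
    ContDiffAt ℝ m (fun p' => dressing (x p') (y p') (a p') z i j) p := by
  have hdot : ∀ (ξ : Fin n → ℂ) (w : ℝ × ℝ → Fin n → ℂ),
      (∀ j, ContDiffAt ℝ m (fun p' => w p' j) p) → ContDiffAt ℝ m (fun p' => ξ ⬝ᵥ w p') p :=
    fun ξ w hw => by
      simp only [dotProduct]
      exact ContDiffAt.sum fun j _ => contDiffAt_const.mul (hw j)
  fin_cases i <;> fin_cases j <;> simp only [dressing]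
  · exact ha.mul (contDiffAt_const.add (hdot _ _ hx))
  · exact ha.mul (hdot _ _ hx)
  · exact (ha.inv ha0).mul (hdot _ _ hy)
  · exact (ha.inv ha0).mul (contDiffAt_const.add (hdot _ _ hy))

theorem differentiableAt_dressing {p : ℝ × ℝ} {x y : ℝ × ℝ → Fin n → ℂ} {a : ℝ × ℝ → ℂ}
    (hx : ∀ j, DifferentiableAt ℝ (fun p' => x p' j) p)
    (hy : ∀ j, DifferentiableAt ℝ (fun p' => y p' j) p)
    (ha : DifferentiableAt ℝ a p) (ha0 : a p ≠ 0) (z : ℂ) (i j : Fin 2) :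
    DifferentiableAt ℝ (fun p' => dressing (x p') (y p') (a p') z i j) p := by
  have hdot : ∀ (ξ : Fin n → ℂ) (w : ℝ × ℝ → Fin n → ℂ),
      (∀ j, DifferentiableAt ℝ (fun p' => w p' j) p) → DifferentiableAt ℝ (fun p' => ξ ⬝ᵥ w p') p :=
    fun ξ w hw => by
      simp only [dotProduct]
      exact DifferentiableAt.fun_sum fun j _ => (hw j).const_mul _
  fin_cases i <;> fin_cases j <;> simp only [dressing]
  · exact ha.fun_mul (DifferentiableAt.const_add _ (hdot _ _ hx))
  · exact ha.fun_mul (hdot _ _ hx)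
  · exact (ha.fun_inv ha0).fun_mul (hdot _ _ hy)
  · exact (ha.fun_inv ha0).fun_mul (DifferentiableAt.const_add _ (hdot _ _ hy))

variable {Ω : Set (ℝ × ℝ)} {q r H : ℝ × ℝ → ℂ} {l : Fin n → ℂ} {f g : Fin n → ℝ × ℝ → ℂ}
  {p : ℝ × ℝ}

theorem isFlowAt_x (hΩ : IsOpen Ω) (hΦ : ∀ k, IsEigenfunction Ω q r (l k) (f k) (g k))
    (hp : p ∈ Ω) :
    (laxPolyU (q p) (r p)).IsFlowAt l (fun y k => f k (y, p.2)) (fun y k => g k (y, p.2)) p.1 := by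
  have e := fun k => (hΦ k).eq_x p hp
  simp only [laxU_eq, LaxPoly.mat] at e
  refine ⟨fun k => (hasDerivAt_dx (((hΦ k).smooth_f.contDiffAt
      (hΩ.mem_nhds hp)).differentiableAt (by simp))).congr_deriv ?_,
    fun k => (hasDerivAt_dx (((hΦ k).smooth_g.contDiffAt
      (hΩ.mem_nhds hp)).differentiableAt (by simp))).congr_deriv ?_⟩
  · simpa [mul_comm] using congrFun (e k) 0
  · simpa [sub_eq_add_neg, mul_comm] using congrFun (e k) 1

theorem isFlowAt_t (hΩ : IsOpen Ω) (hΦ : ∀ k, IsEigenfunction Ω q r (l k) (f k) (g k))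
    (hp : p ∈ Ω) :
    (laxPolyV (q p) (r p) (dx q p) (dx r p)).IsFlowAt l (fun s k => f k (p.1, s))
      (fun s k => g k (p.1, s)) p.2 := by
  have e := fun k => (hΦ k).eq_t p hp
  simp only [laxV_eq, LaxPoly.mat] at e
  refine ⟨fun k => (hasDerivAt_dt (((hΦ k).smooth_f.contDiffAt
      (hΩ.mem_nhds hp)).differentiableAt (by simp))).congr_deriv ?_,
    fun k => (hasDerivAt_dt (((hΦ k).smooth_g.contDiffAt
      (hΩ.mem_nhds hp)).differentiableAt (by simp))).congr_deriv ?_⟩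
  · simpa [mul_comm] using congrFun (e k) 0
  · simpa [sub_eq_add_neg, mul_comm] using congrFun (e k) 1

variable [NeZero n]

/-- For odd `n`, the factor `H` compensates for the sign `(-1) ^ n` in the logarithmic derivative of
`|Δ²| / |Δ¹|`. -/
theorem hasDerivAt_gaugeSq {M : LaxPoly} {l : Fin n → ℂ} {f g : Fin n → ℝ × ℝ → ℂ}
    {H : ℝ × ℝ → ℂ} {c : ℝ → ℝ × ℝ} {y : ℝ}
    (h : M.IsFlowAt l (fun t k => f k (c t)) (fun t k => g k (c t)) y)
    (hH : HasDerivAt (fun t => H (c t)) (2 * M.p0 * H (c y)) y)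
    (h1 : det1 l f g (c y) ≠ 0) (h2 : det2 l f g (c y) ≠ 0) :
    HasDerivAt (fun t => gaugeSq l f g H (c t))
      ((M.p0 - (M.dress (coeffs l f g (c y)) (coeffs l g f (c y))).p0)
        * gaugeSq l f g H (c y)) y := by
  have hd := LaxPoly.hasDerivAt_det_div_det h h2 h1
  have hd' : HasDerivAt (fun t => det2 l f g (c t) / det1 l f g (c t))
    (((-1) ^ n * M.p0 - (M.dress (coeffs l f g (c y)) (coeffs l g f (c y))).p0)
      * (det2 l f g (c y) / det1 l f g (c y))) y := hd
  by_cases hn : Even n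
  · simp only [gaugeSq, hn, if_true, one_mul]
    refine hd'.congr_deriv ?_
    rw [hn.neg_one_pow, one_mul]
  · simp only [gaugeSq, hn, if_false]
    refine (hH.fun_mul hd').congr_deriv ?_
    rw [(Nat.not_even_iff_odd.1 hn).neg_one_pow]
    ring

theorem hasDerivAt_gaugeSq_x (hΩ : IsOpen Ω) (hH : IsOverallFactor Ω q r H)
    (hΦ : ∀ k, IsEigenfunction Ω q r (l k) (f k) (g k)) (hp : p ∈ Ω)
    (h1 : det1 l f g p ≠ 0) (h2 : det2 l f g p ≠ 0) :
    HasDerivAt (fun y => gaugeSq l f g H (y, p.2))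
      (((laxPolyU (q p) (r p)).p0
        - ((laxPolyU (q p) (r p)).dress (coeffs l f g p) (coeffs l g f p)).p0)
        * gaugeSq l f g H p) p.1 := by
  refine hasDerivAt_gaugeSq (c := fun y => (y, p.2)) (isFlowAt_x hΩ hΦ hp) ?_ h1 h2
  refine (hasDerivAt_dx ((hH.smooth.contDiffAt
    (hΩ.mem_nhds hp)).differentiableAt (by simp))).congr_deriv ?_
  rw [hH.eq_x p hp, laxPolyU]
  ring

theorem hasDerivAt_gaugeSq_t (hΩ : IsOpen Ω) (hH : IsOverallFactor Ω q r H)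
    (hΦ : ∀ k, IsEigenfunction Ω q r (l k) (f k) (g k)) (hp : p ∈ Ω)
    (h1 : det1 l f g p ≠ 0) (h2 : det2 l f g p ≠ 0) :
    HasDerivAt (fun s => gaugeSq l f g H (p.1, s))
      (((laxPolyV (q p) (r p) (dx q p) (dx r p)).p0
        - ((laxPolyV (q p) (r p) (dx q p) (dx r p)).dress (coeffs l f g p) (coeffs l g f p)).p0)
        * gaugeSq l f g H p) p.2 := by
  refine hasDerivAt_gaugeSq (c := fun s => (p.1, s)) (isFlowAt_t hΩ hΦ hp) ?_ h1 h2
  refine (hasDerivAt_dt ((hH.smooth.contDiffAt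
    (hΩ.mem_nhds hp)).differentiableAt (by simp))).congr_deriv ?_
  rw [hH.eq_t p hp, laxPolyV]
  ring

theorem gauge_laxPolyU (hH : H p ≠ 0) (h1 : det1 l f g p ≠ 0) (h2 : det2 l f g p ≠ 0) :
    (laxPolyU (q p) (r p)).gauge (coeffs l f g p) (coeffs l g f p) (gaugeSq l f g H p)
      = laxPolyU (qn l f g q H p) (rn l f g r H p) := by
  rw [laxPolyU_gauge _ _ _ (gaugeSq_ne_zero hH h1 h2), qn_eq hH h1 h2, rn_eq h1 h2]

theorem gauge_laxPolyV (hΩ : IsOpen Ω) (hqr : IsSolution Ω q r) (hH : IsOverallFactor Ω q r H)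
    (hΦ : ∀ k, IsEigenfunction Ω q r (l k) (f k) (g k)) (h1 : ∀ p ∈ Ω, det1 l f g p ≠ 0)
    (h2 : ∀ p ∈ Ω, det2 l f g p ≠ 0) (hp : p ∈ Ω) :
    (laxPolyV (q p) (r p) (dx q p) (dx r p)).gauge (coeffs l f g p) (coeffs l g f p)
        (gaugeSq l f g H p)
      = laxPolyV (qn l f g q H p) (rn l f g r H p) (dx (qn l f g q H) p)
        (dx (rn l f g r H) p) := by
  have hΩp := hΩ.mem_nhds hp
  have hρ0 := gaugeSq_ne_zero (hH.ne_zero p hp) (h1 p hp) (h2 p hp)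
  have hρ := hasDerivAt_gaugeSq_x hΩ hH hΦ hp (h1 p hp) (h2 p hp)
  have hfl := isFlowAt_x hΩ hΦ hp
  have hx : HasDerivAt (fun y => coeffs l f g (y, p.2) 0)
      ((laxPolyU (q p) (r p)).flow (coeffs l f g p) (coeffs l g f p) 0) p.1 :=
    LaxPoly.hasDerivAt_rowCoeff hfl (h2 p hp) (h1 p hp) 0
  have hy : HasDerivAt (fun y => coeffs l g f (y, p.2) 0)
      ((laxPolyU (q p) (r p)).swap.flow (coeffs l g f p) (coeffs l f g p) 0) p.1 :=
    LaxPoly.hasDerivAt_rowCoeff hfl.swap (h1 p hp) (h2 p hp) 0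
  have hq := hasDerivAt_dx ((hqr.smooth_q.contDiffAt hΩp).differentiableAt (by simp))
  have hr := hasDerivAt_dx ((hqr.smooth_r.contDiffAt hΩp).differentiableAt (by simp))
  rw [laxPolyV_gauge _ _ _ _ _ hρ0, qn_eq (hH.ne_zero p hp) (h1 p hp) (h2 p hp),
    rn_eq (h1 p hp) (h2 p hp)]
  have eq : qn l f g q H =ᶠ[𝓝 p] fun p => (q p + 2 * I * coeffs l g f p 0) / gaugeSq l f g H p := by
    filter_upwards [hΩp] with p' hp' using qn_eq (hH.ne_zero p' hp') (h1 p' hp') (h2 p' hp')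
  have er : rn l f g r H =ᶠ[𝓝 p] fun p => gaugeSq l f g H p * (r p - 2 * I * coeffs l f g p 0) := by
    filter_upwards [hΩp] with p' hp' using rn_eq (h1 p' hp') (h2 p' hp')
  have dq := ((hq.fun_add (hy.const_mul (2 * I))).fun_div hρ hρ0).deriv
  have dr := (hρ.fun_mul (hr.fun_sub (hx.const_mul (2 * I)))).deriv
  have eq' : dx (qn l f g q H) p = _ := (dx_congr eq).trans dq
  have er' : dx (rn l f g r H) p = _ := (dx_congr er).trans dr
  rw [eq', er']
  congr 1
  · field_simp
  · ring

theorem contDiffAt_qn (hΩ : IsOpen Ω) (hqr : IsSolution Ω q r) (hH : IsOverallFactor Ω q r H)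
    (hΦ : ∀ k, IsEigenfunction Ω q r (l k) (f k) (g k)) (h1 : ∀ p ∈ Ω, det1 l f g p ≠ 0)
    (h2 : ∀ p ∈ Ω, det2 l f g p ≠ 0) (hp : p ∈ Ω) : ContDiffAt ℝ 2 (qn l f g q H) p := by
  have hΩp := hΩ.mem_nhds hp
  have hf := fun k => (hΦ k).smooth_f.contDiffAt hΩp
  have hg := fun k => (hΦ k).smooth_g.contDiffAt hΩp
  have hρ := contDiffAt_gaugeSq hf hg (hH.smooth.contDiffAt hΩp) (h1 p hp)
  have h : ContDiffAt ℝ 2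
      (fun p => (q p + 2 * I * coeffs l g f p 0) * (gaugeSq l f g H p)⁻¹) p :=
    ((hqr.smooth_q.contDiffAt hΩp).add (contDiffAt_const.mul
      (contDiffAt_coeffs hg hf (h1 p hp) 0))).mul
      (hρ.inv (gaugeSq_ne_zero (hH.ne_zero p hp) (h1 p hp) (h2 p hp)))
  refine h.congr_of_eventuallyEq ?_
  filter_upwards [hΩp] with p' hp' using qn_eq (hH.ne_zero p' hp') (h1 p' hp') (h2 p' hp')

theorem contDiffAt_rn (hΩ : IsOpen Ω) (hqr : IsSolution Ω q r) (hH : IsOverallFactor Ω q r H)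
    (hΦ : ∀ k, IsEigenfunction Ω q r (l k) (f k) (g k)) (h1 : ∀ p ∈ Ω, det1 l f g p ≠ 0)
    (h2 : ∀ p ∈ Ω, det2 l f g p ≠ 0) (hp : p ∈ Ω) : ContDiffAt ℝ 2 (rn l f g r H) p := by
  have hΩp := hΩ.mem_nhds hp
  have hf := fun k => (hΦ k).smooth_f.contDiffAt hΩp
  have hg := fun k => (hΦ k).smooth_g.contDiffAt hΩp
  have hρ := contDiffAt_gaugeSq hf hg (hH.smooth.contDiffAt hΩp) (h1 p hp)
  have h : ContDiffAt ℝ 2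
      (fun p => gaugeSq l f g H p * (r p - 2 * I * coeffs l f g p 0)) p :=
    hρ.mul ((hqr.smooth_r.contDiffAt hΩp).sub (contDiffAt_const.mul
      (contDiffAt_coeffs hf hg (h2 p hp) 0)))
  refine h.congr_of_eventuallyEq ?_
  filter_upwards [hΩp] with p' hp' using rn_eq (h1 p' hp') (h2 p' hp')

/-! ### The intertwining relations -/

theorem dressing_intertwines_x (hΩ : IsOpen Ω) (hH : IsOverallFactor Ω q r H)
    (hΦ : ∀ k, IsEigenfunction Ω q r (l k) (f k) (g k)) (h1 : ∀ p ∈ Ω, det1 l f g p ≠ 0)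
    (h2 : ∀ p ∈ Ω, det2 l f g p ≠ 0) (hp : p ∈ Ω) {a : ℝ × ℝ → ℂ} (ha : DifferentiableAt ℝ a p)
    (haρ : ∀ᶠ p' in 𝓝 p, a p' ^ 2 = gaugeSq l f g H p') (z : ℂ) :
    HasMatDerivAt
      (fun y => dressing (coeffs l f g (y, p.2)) (coeffs l g f (y, p.2)) (a (y, p.2)) z)
      (laxU (qn l f g q H) (rn l f g r H) z p
          * dressing (coeffs l f g p) (coeffs l g f p) (a p) z
        - dressing (coeffs l f g p) (coeffs l g f p) (a p) z * laxU q r z p) p.1 := by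
  rw [laxU_eq, laxU_eq, ← gauge_laxPolyU (hH.ne_zero p hp) (h1 p hp) (h2 p hp)]
  exact hasMatDerivAt_dressing (isFlowAt_x hΩ hΦ hp) (h2 p hp) (h1 p hp)
    (hasDerivAt_gaugeSq_x hΩ hH hΦ hp (h1 p hp) (h2 p hp))
    (gaugeSq_ne_zero (hH.ne_zero p hp) (h1 p hp) (h2 p hp)) (hasDerivAt_dx ha).differentiableAt
    ((tendsto_slice_x p).eventually haρ) z

theorem dressing_intertwines_t (hΩ : IsOpen Ω) (hqr : IsSolution Ω q r)
    (hH : IsOverallFactor Ω q r H)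
    (hΦ : ∀ k, IsEigenfunction Ω q r (l k) (f k) (g k)) (h1 : ∀ p ∈ Ω, det1 l f g p ≠ 0)
    (h2 : ∀ p ∈ Ω, det2 l f g p ≠ 0) (hp : p ∈ Ω) {a : ℝ × ℝ → ℂ} (ha : DifferentiableAt ℝ a p)
    (haρ : ∀ᶠ p' in 𝓝 p, a p' ^ 2 = gaugeSq l f g H p') (z : ℂ) :
    HasMatDerivAt
      (fun s => dressing (coeffs l f g (p.1, s)) (coeffs l g f (p.1, s)) (a (p.1, s)) z)
      (laxV (qn l f g q H) (rn l f g r H) z p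
          * dressing (coeffs l f g p) (coeffs l g f p) (a p) z
        - dressing (coeffs l f g p) (coeffs l g f p) (a p) z * laxV q r z p) p.2 := by
  rw [laxV_eq, laxV_eq, ← gauge_laxPolyV hΩ hqr hH hΦ h1 h2 hp]
  exact hasMatDerivAt_dressing (isFlowAt_t hΩ hΦ hp) (h2 p hp) (h1 p hp)
    (hasDerivAt_gaugeSq_t hΩ hH hΦ hp (h1 p hp) (h2 p hp))
    (gaugeSq_ne_zero (hH.ne_zero p hp) (h1 p hp) (h2 p hp)) (hasDerivAt_dt ha).differentiableAt
    ((tendsto_slice_t p).eventually haρ) z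

theorem eq_zero_of_mul_eq_zero_of_det_ne_zero {A B : Matrix (Fin 2) (Fin 2) ℂ} (hB : B.det ≠ 0)
    (h : A * B = 0) : A = 0 := by
  rw [← mul_nonsing_inv_cancel_right B A (isUnit_iff_ne_zero.2 hB), h, Matrix.zero_mul]

/-- The square root `a` of `gaugeSq` needed for the Darboux matrix exists locally, which suffices
since the equations are local. -/
theorem isSolution_qn_rn (hΩ : IsOpen Ω) (hqr : IsSolution Ω q r) (hH : IsOverallFactor Ω q r H)
    (hΦ : ∀ k, IsEigenfunction Ω q r (l k) (f k) (g k)) (h1 : ∀ p ∈ Ω, det1 l f g p ≠ 0)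
    (h2 : ∀ p ∈ Ω, det2 l f g p ≠ 0) : IsSolution Ω (qn l f g q H) (rn l f g r H) := by
  have key : ∀ p ∈ Ω,
      dt (rn l f g r H) p - I * dx (dx (rn l f g r H)) p
          + I * rn l f g r H p ^ 2 * qn l f g q H p
          + rn l f g r H p * qn l f g q H p * dx (rn l f g r H) p = 0 ∧
        dt (qn l f g q H) p + I * dx (dx (qn l f g q H)) p
          - I * qn l f g q H p ^ 2 * rn l f g r H p
          + qn l f g q H p * rn l f g r H p * dx (qn l f g q H) p = 0 := by
    intro p hp
    have hΩp := hΩ.mem_nhds hp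
    have hf := fun k => (hΦ k).smooth_f.contDiffAt hΩp
    have hg := fun k => (hΦ k).smooth_g.contDiffAt hΩp
    have hρ0 := gaugeSq_ne_zero (hH.ne_zero p hp) (h1 p hp) (h2 p hp)
    obtain ⟨a, ha, haρ⟩ := exists_local_sqrt
      (contDiffAt_gaugeSq hf hg (hH.smooth.contDiffAt hΩp) (h1 p hp)) hρ0
    have ha0 : a p ≠ 0 := fun h0 => hρ0 (by rw [← haρ.self_of_nhds, h0]; simp)
    obtain ⟨z, hz, hdet⟩ := exists_det_dressing_ne_zero (coeffs l f g p) (coeffs l g f p) ha0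
    have hev := (hΩ.eventually_mem hp).and ((ha.eventually (by simp)).and haρ.eventually_nhds)
    have slices : ∀ q r : ℝ × ℝ → ℂ, ContDiffAt ℝ 2 q p → ContDiffAt ℝ 2 r p →
        HasMatDerivAt (fun s => laxU q r z (p.1, s))
          (laxPolyUDeriv (q p) (r p) (dt q p) (dt r p) z) p.2 ∧
        HasMatDerivAt (fun y => laxV q r z (y, p.2))
          (laxPolyVDeriv (q p) (r p) (dx q p) (dx r p) (dx q p) (dx r p) (dx (dx q) p)
            (dx (dx r) p) z) p.1 := fun q r hq hr => by
      simp only [laxU_eq, laxV_eq]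
      exact ⟨hasMatDerivAt_laxPolyU (hasDerivAt_dt (hq.differentiableAt (by simp)))
          (hasDerivAt_dt (hr.differentiableAt (by simp))) z,
        hasMatDerivAt_laxPolyV (hasDerivAt_dx (hq.differentiableAt (by simp)))
          (hasDerivAt_dx (hr.differentiableAt (by simp))) (hasDerivAt_dx (differentiableAt_dx hq))
          (hasDerivAt_dx (differentiableAt_dx hr)) z⟩
    have s0 := slices q r (hqr.smooth_q.contDiffAt hΩp) (hqr.smooth_r.contDiffAt hΩp)
    have s1 := slices _ _ (contDiffAt_qn hΩ hqr hH hΦ h1 h2 hp)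
      (contDiffAt_rn hΩ hqr hH hΦ h1 h2 hp)
    have hc := curvature_intertwine
      (T := fun p => dressing (coeffs l f g p) (coeffs l g f p) (a p) z)
      (contDiffAt_dressing (contDiffAt_coeffs hf hg (h2 p hp)) (contDiffAt_coeffs hg hf (h1 p hp))
        ha ha0 z)
      (hev.mono fun p' h => dressing_intertwines_x hΩ hH hΦ h1 h2 h.1
        (h.2.1.differentiableAt (by simp)) h.2.2 z)
      (hev.mono fun p' h => dressing_intertwines_t hΩ hqr hH hΦ h1 h2 h.1
        (h.2.1.differentiableAt (by simp)) h.2.2 z)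
      s0.1 s1.1 s0.2 s1.2
    simp only [laxU_eq, laxV_eq, curvature_eq, hqr.eq_r p hp, hqr.eq_q p hp, mul_zero, add_zero,
      neg_zero] at hc
    have hzero : (!![0, 0; 0, 0] : Matrix (Fin 2) (Fin 2) ℂ) = 0 := by
      ext i j; fin_cases i <;> fin_cases j <;> rfl
    rw [hzero, Matrix.mul_zero] at hc
    have hm := eq_zero_of_mul_eq_zero_of_det_ne_zero hdet hc
    exact ⟨(mul_eq_zero.1 (congrFun (congrFun hm 0) 1)).resolve_left hz,
      (mul_eq_zero.1 (congrFun (congrFun hm 1) 0)).resolve_left hz⟩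
  exact ⟨fun p hp => (contDiffAt_qn hΩ hqr hH hΦ h1 h2 hp).contDiffWithinAt,
    fun p hp => (contDiffAt_rn hΩ hqr hH hΦ h1 h2 hp).contDiffWithinAt,
    fun p hp => (key p hp).1, fun p hp => (key p hp).2⟩

end

section

/-! ### The `n`-fold Darboux matrix -/

variable {n : ℕ}

/-- The factor `a` with `a ^ 2 = gaugeSq` that corresponds to the branches `s` of
`√(|Δ¹| |Δ²|)` and `h` of `√H`. -/
def gaugeRoot (l : Fin n → ℂ) (f g : Fin n → ℝ × ℝ → ℂ) (s h : ℝ × ℝ → ℂ) (p : ℝ × ℝ) : ℂ :=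
  (if Even n then 1 else h p) * det2 l f g p / s p

theorem gaugeRoot_sq {l : Fin n → ℂ} {f g : Fin n → ℝ × ℝ → ℂ} {s h H : ℝ × ℝ → ℂ} {p : ℝ × ℝ}
    (h1 : det1 l f g p ≠ 0) (h2 : det2 l f g p ≠ 0) (hs : s p ^ 2 = det1 l f g p * det2 l f g p)
    (hh : h p ^ 2 = H p) : gaugeRoot l f g s h p ^ 2 = gaugeSq l f g H p := by
  rw [gaugeRoot, gaugeSq, div_pow, mul_pow, hs]
  split_ifs
  · field_simp
  · rw [hh]; field_simp

theorem Tn_eq_dressing {l : Fin n → ℂ} {f g : Fin n → ℝ × ℝ → ℂ} {s h : ℝ × ℝ → ℂ} {p : ℝ × ℝ}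
    (h1 : det1 l f g p ≠ 0) (h2 : det2 l f g p ≠ 0) (hs : s p ^ 2 = det1 l f g p * det2 l f g p)
    (hh : h p ≠ 0) (z : ℂ) :
    Tn l f g s h z p
      = dressing (coeffs l f g p) (coeffs l g f p) (gaugeRoot l f g s h p) z := by
  have hs0 : s p ≠ 0 := fun h0 => mul_ne_zero h1 h2 (by rw [← hs, h0]; simp)
  have e2 := bordered_eq (l := l) (u := fun k => f k p) (v := fun k => g k p) h2
  have e1 := bordered_eq (l := l) (u := fun k => g k p) (v := fun k => f k p) h1
  have d2 : (Delta2 l (fun k => f k p) fun k => g k p).det = det2 l f g p := rfl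
  have d1 : (Delta2 l (fun k => g k p) fun k => f k p).det = det1 l f g p := rfl
  have hinv : (gaugeRoot l f g s h p)⁻¹ = (if Even n then 1 else 1 / h p) * det1 l f g p / s p := by
    rw [gaugeRoot]
    split_ifs <;> field_simp <;> rw [hs, mul_comm]
  rw [dressing, hinv, gaugeRoot, Tn, Tcore]
  simp only [Delta1_eq_Delta2, e1, e2, d1, d2, coeffs]
  split_ifs
  · ext i j
    fin_cases i <;> fin_cases j <;> simp <;> ring
  · ext i j
    fin_cases i <;> fin_cases j <;> simp <;> ring

theorem IsDarboux.of_eqOn {Ω : Set (ℝ × ℝ)} (hΩ : IsOpen Ω) {q r q₁ r₁ q₂ r₂ : ℝ × ℝ → ℂ}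
    {T : ℂ → ℝ × ℝ → Matrix (Fin 2) (Fin 2) ℂ} (h : IsDarboux Ω q r q₁ r₁ T)
    (hq : Set.EqOn q₂ q₁ Ω) (hr : Set.EqOn r₂ r₁ Ω) : IsDarboux Ω q r q₂ r₂ T := by
  refine ⟨h.diff, h.nondeg, fun z p hp => ?_, fun z p hp => ?_⟩
  · rw [h.eq_x z p hp, laxU_eq, laxU_eq, hq hp, hr hp]
  · rw [h.eq_t z p hp, laxV_eq, laxV_eq, hq hp, hr hp,
      dx_congr (hq.eventuallyEq_of_mem (hΩ.mem_nhds hp)),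
      dx_congr (hr.eventuallyEq_of_mem (hΩ.mem_nhds hp))]

variable [NeZero n]

theorem isDarboux_Tn {Ω : Set (ℝ × ℝ)} (hΩ : IsOpen Ω) {q r H : ℝ × ℝ → ℂ} {l : Fin n → ℂ}
    {f g : Fin n → ℝ × ℝ → ℂ} (hqr : IsSolution Ω q r) (hH : IsOverallFactor Ω q r H)
    (hΦ : ∀ k, IsEigenfunction Ω q r (l k) (f k) (g k)) (h1 : ∀ p ∈ Ω, det1 l f g p ≠ 0)
    (h2 : ∀ p ∈ Ω, det2 l f g p ≠ 0) {s h : ℝ × ℝ → ℂ} (hs : DifferentiableOn ℝ s Ω)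
    (hh : DifferentiableOn ℝ h Ω) (hs2 : ∀ p ∈ Ω, s p ^ 2 = det1 l f g p * det2 l f g p)
    (hh2 : ∀ p ∈ Ω, h p ^ 2 = H p) :
    IsDarboux Ω q r (qn l f g q H) (rn l f g r H) (Tn l f g s h) := by
  have hf := fun k p hp => ((hΦ k).smooth_f.contDiffAt (hΩ.mem_nhds hp) : ContDiffAt ℝ 2 _ p)
  have hg := fun k p hp => ((hΦ k).smooth_g.contDiffAt (hΩ.mem_nhds hp) : ContDiffAt ℝ 2 _ p)
  have hs0 : ∀ p ∈ Ω, s p ≠ 0 := fun p hp h0 =>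
    mul_ne_zero (h1 p hp) (h2 p hp) (by rw [← hs2 p hp, h0]; simp)
  have hh0 : ∀ p ∈ Ω, h p ≠ 0 := fun p hp h0 =>
    hH.ne_zero p hp (by rw [← hh2 p hp, h0]; simp)
  have hsq : ∀ p ∈ Ω, gaugeRoot l f g s h p ^ 2 = gaugeSq l f g H p := fun p hp =>
    gaugeRoot_sq (h1 p hp) (h2 p hp) (hs2 p hp) (hh2 p hp)
  have ha0 : ∀ p ∈ Ω, gaugeRoot l f g s h p ≠ 0 := fun p hp h0 =>
    gaugeSq_ne_zero (hH.ne_zero p hp) (h1 p hp) (h2 p hp) (by rw [← hsq p hp, h0]; simp)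
  have ha : ∀ p ∈ Ω, DifferentiableAt ℝ (gaugeRoot l f g s h) p := fun p hp => by
    have hd : DifferentiableAt ℝ (det2 l f g) p :=
      (contDiffAt_det (contDiffAt_Delta2 (fun k => hf k p hp) fun k => hg k p hp)).differentiableAt
        (by simp)
    have hc : DifferentiableAt ℝ (fun p => if Even n then 1 else h p) p := by
      split_ifs
      exacts [differentiableAt_const _, hh.differentiableAt (hΩ.mem_nhds hp)]
    unfold gaugeRoot
    simp only [div_eq_mul_inv]
    exact (hc.mul hd).mul ((hs.differentiableAt (hΩ.mem_nhds hp)).fun_inv (hs0 p hp))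
  have hT : ∀ z, ∀ p ∈ Ω, Tn l f g s h z p
      = dressing (coeffs l f g p) (coeffs l g f p) (gaugeRoot l f g s h p) z := fun z p hp =>
    Tn_eq_dressing (h1 p hp) (h2 p hp) (hs2 p hp) (hh0 p hp) z
  have hTe : ∀ z i j, ∀ p ∈ Ω, (fun p => Tn l f g s h z p i j) =ᶠ[𝓝 p] fun p =>
      dressing (coeffs l f g p) (coeffs l g f p) (gaugeRoot l f g s h p) z i j :=
    fun z i j p hp => by
      filter_upwards [hΩ.mem_nhds hp] with p' hp'
      rw [hT z p' hp']
  have hev : ∀ p ∈ Ω, ∀ᶠ p' in 𝓝 p, gaugeRoot l f g s h p' ^ 2 = gaugeSq l f g H p' :=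
    fun p hp => by filter_upwards [hΩ.mem_nhds hp] with p' hp' using hsq p' hp'
  refine ⟨fun z i j p hp => ?_, fun p hp => ?_, fun z p hp => ?_, fun z p hp => ?_⟩
  · have hx := fun j => (contDiffAt_coeffs (fun k => hf k p hp) (fun k => hg k p hp)
      (h2 p hp) j).differentiableAt (by simp)
    have hy := fun j => (contDiffAt_coeffs (fun k => hg k p hp) (fun k => hf k p hp)
      (h1 p hp) j).differentiableAt (by simp)
    exact ((differentiableAt_dressing hx hy (ha p hp) (ha0 p hp) z i j).congr_of_eventuallyEq
      (hTe z i j p hp)).differentiableWithinAt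
  · obtain ⟨z, -, hz⟩ := exists_det_dressing_ne_zero (coeffs l f g p) (coeffs l g f p) (ha0 p hp)
    exact ⟨z, by rwa [hT z p hp]⟩
  · have hd := dressing_intertwines_x hΩ hH hΦ h1 h2 hp (ha p hp) (hev p hp) z
    have : matDx (Tn l f g s h z) p = _ :=
      Matrix.ext fun i j => (dx_congr (hTe z i j p hp)).trans (hd i j).deriv
    rw [this, hT z p hp, sub_add_cancel]
  · have hd := dressing_intertwines_t hΩ hqr hH hΦ h1 h2 hp (ha p hp) (hev p hp) z
    have : matDt (Tn l f g s h z) p = _ :=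
      Matrix.ext fun i j => (dt_congr (hTe z i j p hp)).trans (hd i j).deriv
    rw [this, hT z p hp, sub_add_cancel]

end

end

end CLLNLS

open CLLNLS in
theorem theorem2 (n : ℕ) (hn : 1 ≤ n) (Ω : Set (ℝ × ℝ)) (hΩ : IsOpen Ω)
    (q r H : ℝ × ℝ → ℂ) (hqr : CLLNLS.IsSolution Ω q r)
    (hH : CLLNLS.IsOverallFactor Ω q r H)
    (l : Fin n → ℂ) (f g : Fin n → ℝ × ℝ → ℂ)
    (hΦ : ∀ k, CLLNLS.IsEigenfunction Ω q r (l k) (f k) (g k))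
    (hΔ1 : ∀ p ∈ Ω, CLLNLS.det1 l f g p ≠ 0)
    (hΔ2 : ∀ p ∈ Ω, CLLNLS.det2 l f g p ≠ 0) :
    CLLNLS.IsSolution Ω (CLLNLS.qn l f g q H) (CLLNLS.rn l f g r H) ∧
    ∀ s h : ℝ × ℝ → ℂ, DifferentiableOn ℝ s Ω → DifferentiableOn ℝ h Ω →
      (∀ p ∈ Ω, s p ^ 2 = CLLNLS.det1 l f g p * CLLNLS.det2 l f g p) →
      (∀ p ∈ Ω, h p ^ 2 = H p) →
      (∀ k, ∀ p ∈ Ω, Matrix.mulVec (CLLNLS.Tn l f g s h (l k) p) ![f k p, g k p] = 0) ∧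
      ∀ q' r' : ℝ × ℝ → ℂ,
        CLLNLS.IsDarboux Ω q r q' r' (CLLNLS.Tn l f g s h) ↔
          Set.EqOn q' (CLLNLS.qn l f g q H) Ω ∧ Set.EqOn r' (CLLNLS.rn l f g r H) Ω := by
  have : NeZero n := ⟨by omega⟩
  refine ⟨isSolution_qn_rn hΩ hqr hH hΦ hΔ1 hΔ2, fun s h hs hh hs2 hh2 => ?_⟩
  have hh0 : ∀ p ∈ Ω, h p ≠ 0 := fun p hp h0 =>
    hH.ne_zero p hp (by rw [← hh2 p hp, h0]; simp)
  have hT : ∀ z, ∀ p ∈ Ω, Tn l f g s h z p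
      = dressing (coeffs l f g p) (coeffs l g f p) (gaugeRoot l f g s h p) z := fun z p hp =>
    Tn_eq_dressing (hΔ1 p hp) (hΔ2 p hp) (hs2 p hp) (hh0 p hp) z
  have hD := isDarboux_Tn hΩ hqr hH hΦ hΔ1 hΔ2 hs hh hs2 hh2
  refine ⟨fun k p hp => ?_, fun q' r' => ⟨fun hD' => ?_, fun he => hD.of_eqOn hΩ he.1 he.2⟩⟩
  · rw [hT _ p hp]
    exact dressing_mulVec (u := fun k => f k p) (v := fun k => g k p) (hΔ2 p hp) (hΔ1 p hp) _ k
  · suffices ∀ p ∈ Ω, q' p = qn l f g q H p ∧ r' p = rn l f g r H p from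
      ⟨fun p hp => (this p hp).1, fun p hp => (this p hp).2⟩
    intro p hp
    have ha0 : gaugeRoot l f g s h p ≠ 0 := fun h0 =>
      gaugeSq_ne_zero (hH.ne_zero p hp) (hΔ1 p hp) (hΔ2 p hp) (by
        rw [← gaugeRoot_sq (hΔ1 p hp) (hΔ2 p hp) (hs2 p hp) (hh2 p hp), h0]; simp)
    obtain ⟨z, hz, hdet⟩ :=
      exists_det_dressing_ne_zero (coeffs l f g p) (coeffs l g f p) ha0
    rw [← hT z p hp] at hdet
    -- At a nonzero `z` where `T_n` is invertible, the two matrices `U'` coincide.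
    have hU : laxU q' r' z p - laxU (qn l f g q H) (rn l f g r H) z p = 0 :=
      eq_zero_of_mul_eq_zero_of_det_ne_zero hdet (by
        rw [Matrix.sub_mul, ← hD'.eq_x z p hp, ← hD.eq_x z p hp, sub_self])
    rw [sub_eq_zero, laxU_eq, laxU_eq] at hU
    have hr := congrFun (congrFun hU 0) 1
    have hq := congrFun (congrFun hU 1) 0
    simp only [LaxPoly.mat, LaxPoly.R, LaxPoly.S, laxPolyU] at hr hq
    exact ⟨by simpa [hz] using hq, by simpa [hz] using hr⟩
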